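/- Let $\mathbb K$ be a number field and let $\mathbf G$ be a reductive algebraic group defined over $\mathbb K$ (not assumed connected), with Lie algebra $\mathfrak g=\mathfrak g(\mathbb K)$ over $\mathbb K$ and dual space $\mathfrak g^*$. Write $\operatorname{Ad}^*$ and $\operatorname{ad}^*$ for the coadjoint actions of $\mathbf G(\mathbb K)$ and $\mathfrak g$ on $\mathfrak g^*$. A functional $\varphi\in\mathfrak g^*$ is called nilpotent if it is the Killing form pairing with a nilpotent element $f\in\mathfrak g$; a nilpotent orbit is an $\operatorname{Ad}^*(\mathbf G(\mathbb K))$-orbit in $\mathfrak g^*$ of a nilpotent functional. An element $Z\in\mathfrak g$ is called rational semisimple if it is semisimple and all eigenvalues of $\operatorname{ad}(Z)$ lie in $\mathbb Q$; for such $Z$ put $(\mathfrak g^*)^Z_{q}=\{\varphi\in\mathfrak g^* : \operatorname{ad}^*(Z)\varphi=q\varphi\}$ for $q\in\mathbb Q$ and $(\mathfrak g^*)^Z_{>0}=\bigoplus_{q\in\mathbb Q,\,q>0}(\mathfrak g^*)^Z_q$. Define a relation $R$ on the set of nilpotent orbits: $(\mathcal O,\mathcal O')\in R$ if $\mathcal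 O\neq\mathcal O'$ and there exist $\varphi\in\mathcal O$, a rational semisimple $Z\in\mathfrak g$ and $\varphi'\in(\mathfrak g^*)^Z_{>0}$ such that $\varphi\in(\mathfrak g^*)^Z_0$ and $\varphi+\varphi'\in\mathcal O'$. Then $R$ is antisymmetric: if $(\mathcal O,\mathcal O')\in R$ then $(\mathcal O',\mathcal O)\notin R$. Moreover, the transitive closure of $R$ is a strict partial order on the set of nilpotent orbits (irreflexive and transitive); equivalently, the reflexive-transitive closure of $R$ is a partial order. -/

import Mathlib

universe u

open scoped DualNumber

-- the commutator bracket on matrices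
attribute [local instance 100] LieRing.ofAssociativeRing

/-- An affine algebraic group over `K`, given as a closed subgroup scheme of `GL n`: a set of
polynomials in the `n ^ 2` matrix entries, with coefficients in `K`, whose zeros in `GL n R` form
a subgroup for every commutative `K`-algebra `R`. (Every affine algebraic group over `K` is of
this form.) -/
structure LinAlgGroup (K : Type u) [Field K] (n : ℕ) where
  equations : Set (MvPolynomial (Fin n × Fin n) K)
  one_mem : ∀ (R : Type u) [CommRing R] [Algebra K R], ∀ p ∈ equations,
    MvPolynomial.aeval (fun ij => (1 : Matrix (Fin n) (Fin n) R) ij.1 ij.2) p = 0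
  mul_mem : ∀ (R : Type u) [CommRing R] [Algebra K R] (g h : GL (Fin n) R),
    (∀ p ∈ equations, MvPolynomial.aeval (fun ij => g ij.1 ij.2) p = 0) →
    (∀ p ∈ equations, MvPolynomial.aeval (fun ij => h ij.1 ij.2) p = 0) →
    ∀ p ∈ equations, MvPolynomial.aeval (fun ij => (g * h) ij.1 ij.2) p = 0
  inv_mem : ∀ (R : Type u) [CommRing R] [Algebra K R] (g : GL (Fin n) R),
    (∀ p ∈ equations, MvPolynomial.aeval (fun ij => g ij.1 ij.2) p = 0) →
    ∀ p ∈ equations, MvPolynomial.aeval (fun ij => g⁻¹ ij.1 ij.2) p = 0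

/-! Zariski-closed subgroups of `GL n F`, used over an algebraically closed field `F`. -/

/-- `U` is the zero locus in `GL n F` of a set of polynomials in the matrix entries. -/
def IsZariskiClosed {F : Type u} [Field F] {n : ℕ} (U : Subgroup (GL (Fin n) F)) : Prop :=
  ∃ S : Set (MvPolynomial (Fin n × Fin n) F), ∀ g : GL (Fin n) F,
    g ∈ U ↔ ∀ p ∈ S, MvPolynomial.aeval (fun ij => g ij.1 ij.2) p = 0

/-- Connectedness of a closed subgroup: there is no proper closed subgroup of finite index. -/
def IsZariskiConnected {F : Type u} [Field F] {n : ℕ} (U : Subgroup (GL (Fin n) F)) : Prop :=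
  ∀ V : Subgroup (GL (Fin n) F), V ≤ U → IsZariskiClosed V → V.relIndex U ≠ 0 → V = U

/-- All elements of `U` are unipotent matrices. -/
def IsUnipotentSubgroup {F : Type u} [Field F] {n : ℕ} (U : Subgroup (GL (Fin n) F)) : Prop :=
  ∀ g ∈ U, IsNilpotent ((g : Matrix (Fin n) (Fin n) F) - 1)

/-- The invertible matrix `1 + r X` over a `K`-algebra, for `X` with entries in `K` and
`r ^ 2 = 0`. -/
def onePlus {K : Type u} [Field K] {n : ℕ} {R : Type u} [CommRing R] [Algebra K R]
    (r : R) (hr : r * r = 0) (X : Matrix (Fin n) (Fin n) K) : GL (Fin n) R where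
  val := 1 + r • X.map (algebraMap K R)
  inv := 1 - r • X.map (algebraMap K R)
  val_inv := by
    simp [add_mul, mul_sub, smul_smul, hr]
  inv_val := by
    simp [sub_mul, mul_add, smul_sub, smul_smul, hr]

namespace LinAlgGroup

variable {K : Type u} [Field K] {n : ℕ} (G : LinAlgGroup K n)

/-- The group `G(R)` of `R`-points, as a subgroup of `GL n R`. -/
def points (R : Type u) [CommRing R] [Algebra K R] : Subgroup (GL (Fin n) R) where
  carrier := {g | ∀ p ∈ G.equations, MvPolynomial.aeval (fun ij => g ij.1 ij.2) p = 0}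
  one_mem' := fun p hp => by simpa using G.one_mem R p hp
  mul_mem' := fun {g h} hg hh => G.mul_mem R g h hg hh
  inv_mem' := fun {g} hg => G.inv_mem R g hg

/-- `G` is reductive: over the algebraic closure, `G` has no nontrivial closed connected
unipotent normal subgroup (the unipotent radical is trivial). -/
def IsReductive : Prop :=
  ∀ U : Subgroup (GL (Fin n) (AlgebraicClosure K)),
    U ≤ G.points (AlgebraicClosure K) →
    (∀ g ∈ G.points (AlgebraicClosure K), ∀ u ∈ U, g * u * g⁻¹ ∈ U) →
    IsZariskiClosed U → IsZariskiConnected U → IsUnipotentSubgroup U → U = ⊥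

/-! The Lie algebra of `G`, by dual numbers. -/

theorem aeval_map {R S : Type u} [CommRing R] [Algebra K R] [CommRing S] [Algebra K S]
    (f : R →ₐ[K] S) (M : Matrix (Fin n) (Fin n) R) (p : MvPolynomial (Fin n × Fin n) K) :
    MvPolynomial.aeval (fun ij => f (M ij.1 ij.2)) p =
      f (MvPolynomial.aeval (fun ij => M ij.1 ij.2) p) :=
  (MvPolynomial.comp_aeval_apply (f := fun ij : Fin n × Fin n => M ij.1 ij.2) f p).symm

theorem map_mem {R S : Type u} [CommRing R] [Algebra K R] [CommRing S] [Algebra K S]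
    (f : R →ₐ[K] S) {g : GL (Fin n) R} (hg : g ∈ G.points R) :
    Matrix.GeneralLinearGroup.map f.toRingHom g ∈ G.points S := fun p hp => by
  have h := aeval_map f (g : Matrix (Fin n) (Fin n) R) p
  rw [hg p hp, map_zero] at h
  simpa using h

theorem map_onePlus {R S : Type u} [CommRing R] [Algebra K R] [CommRing S] [Algebra K S]
    (f : R →ₐ[K] S) (r : R) (hr : r * r = 0) (s : S) (hs : s * s = 0) (h : f r = s)
    (X : Matrix (Fin n) (Fin n) K) :
    Matrix.GeneralLinearGroup.map f.toRingHom (onePlus r hr X) = onePlus s hs X := by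
  ext i j
  by_cases hij : i = j <;> simp [onePlus, hij, h]

theorem onePlus_zero {R : Type u} [CommRing R] [Algebra K R] (r : R) (hr : r * r = 0) :
    onePlus r hr (0 : Matrix (Fin n) (Fin n) K) = 1 := by
  ext i j
  simp [onePlus]

theorem onePlus_add {R : Type u} [CommRing R] [Algebra K R] (r : R) (hr : r * r = 0)
    (X Y : Matrix (Fin n) (Fin n) K) :
    onePlus r hr (X + Y) = onePlus r hr X * onePlus r hr Y := by
  apply Units.ext
  simp only [onePlus, Units.val_mul]
  rw [Matrix.map_add _ (fun a b => map_add _ a b)]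
  simp [add_mul, mul_add, smul_smul, hr, add_comm, add_assoc]

theorem onePlus_smul {R : Type u} [CommRing R] [Algebra K R] (r : R) (hr : r * r = 0) (c : K)
    (hc : (c • r) * (c • r) = 0) (X : Matrix (Fin n) (Fin n) K) :
    onePlus r hr (c • X) = onePlus (c • r) hc X := by
  ext i j
  by_cases hij : i = j <;> simp [onePlus, hij] <;>
    simp [Algebra.smul_def, mul_left_comm]

theorem onePlus_bracket {R : Type u} [CommRing R] [Algebra K R] (a b : R) (ha : a * a = 0)
    (hb : b * b = 0) (hab : (a * b) * (a * b) = 0) (X Y : Matrix (Fin n) (Fin n) K) :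
    onePlus a ha X * onePlus b hb Y * (onePlus a ha X)⁻¹ * (onePlus b hb Y)⁻¹ =
      onePlus (a * b) hab ⁅X, Y⁆ := by
  rw [mul_inv_eq_iff_eq_mul, mul_inv_eq_iff_eq_mul]
  apply Units.ext
  simp only [onePlus, Units.val_mul, Ring.lie_def]
  rw [Matrix.map_sub _ (fun a b => map_sub _ a b), Matrix.map_mul, Matrix.map_mul]
  have h1 : b * (a * b) = 0 := by rw [mul_left_comm, hb, mul_zero]
  have h2 : a * (a * b) = 0 := by rw [← mul_assoc, ha, zero_mul]
  simp [add_mul, mul_add, smul_smul, smul_sub, sub_mul, h1, h2, mul_comm b a]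
  abel

theorem mul_mul_self_eq_zero {R : Type u} [CommRing R] (a b : R) (ha : a * a = 0) :
    (a * b) * (a * b) = 0 := by
  rw [mul_mul_mul_comm, ha, zero_mul]

theorem exists_hom_dualNumber {R : Type u} [CommRing R] [Algebra K R] (r : R) (hr : r * r = 0) :
    ∃ f : K[ε] →ₐ[K] R, f DualNumber.eps = r :=
  ⟨DualNumber.lift ⟨(Algebra.ofId K R, r), hr, fun _ => Commute.all _ _⟩, by simp⟩

/-- The ring `K[ε][ε']`, into which `K[ε]` embeds by `ε ↦ ε ε'`. -/
theorem exists_two_infinitesimals (K : Type u) [Field K] :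
    ∃ (R : Type u) (_ : CommRing R) (_ : Algebra K R) (a b : R) (f : K[ε] →ₐ[K] R),
      a * a = 0 ∧ b * b = 0 ∧ f DualNumber.eps = a * b ∧ Function.Injective f := by
  have ha : (algebraMap K[ε] (K[ε])[ε] DualNumber.eps) *
      (algebraMap K[ε] (K[ε])[ε] DualNumber.eps) = 0 := by
    rw [← map_mul, DualNumber.eps_mul_eps, map_zero]
  have hb : (DualNumber.eps : (K[ε])[ε]) * DualNumber.eps = 0 := DualNumber.eps_mul_eps
  obtain ⟨f, hf⟩ := exists_hom_dualNumber (K := K)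
    ((algebraMap K[ε] (K[ε])[ε] DualNumber.eps) * DualNumber.eps)
    (mul_mul_self_eq_zero _ _ ha)
  refine ⟨(K[ε])[ε], inferInstance, inferInstance, _, _, f, ha, hb, hf, ?_⟩
  rw [injective_iff_map_eq_zero]
  intro x hx
  have hx' : x = algebraMap K K[ε] x.fst + x.snd • DualNumber.eps := by
    ext <;> simp [TrivSqZeroExt.algebraMap_eq_inl]
  rw [hx', map_add, map_smul, hf, AlgHom.commutes] at hx
  have h1 := congrArg (fun z : (K[ε])[ε] => z.fst.fst) hx
  have h2 := congrArg (fun z : (K[ε])[ε] => z.snd.snd) hx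
  have h0 : algebraMap K (K[ε])[ε] x.fst = TrivSqZeroExt.inl (TrivSqZeroExt.inl x.fst) := rfl
  simp [TrivSqZeroExt.algebraMap_eq_inl, h0] at h1 h2
  ext
  · simpa using h1
  · simpa using h2

/-- The Lie algebra `𝔤` of `G` over `K`: the matrices `X` such that `1 + ε X` is a point of `G`
over the dual numbers `K[ε]`. -/
def lieAlg : LieSubalgebra K (Matrix (Fin n) (Fin n) K) where
  carrier := {X | onePlus (DualNumber.eps : K[ε]) DualNumber.eps_mul_eps X ∈ G.points K[ε]}
  zero_mem' := by
    simp only [Set.mem_ofPred_eq, onePlus_zero]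
    exact (G.points K[ε]).one_mem
  add_mem' := fun {X Y} hX hY => by
    simp only [Set.mem_ofPred_eq, onePlus_add] at *
    exact (G.points K[ε]).mul_mem hX hY
  smul_mem' := fun c X hX => by
    have hc : (c • (DualNumber.eps : K[ε])) * (c • DualNumber.eps) = 0 := by simp
    simp only [Set.mem_ofPred_eq] at *
    rw [onePlus_smul _ _ c hc, ← map_onePlus
      (DualNumber.lift ⟨(Algebra.ofId K K[ε], c • DualNumber.eps), hc, fun _ => Commute.all _ _⟩)
      DualNumber.eps DualNumber.eps_mul_eps _ hc (by simp)]
    exact G.map_mem _ hX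
  lie_mem' := fun {X Y} hX hY => by
    simp only [Set.mem_ofPred_eq] at *
    obtain ⟨R, _, _, a, b, fc, ha, hb, hfc, hinj⟩ := exists_two_infinitesimals K
    have hab : (a * b) * (a * b) = 0 := mul_mul_self_eq_zero a b ha
    obtain ⟨fa, hfa⟩ := exists_hom_dualNumber (K := K) a ha
    obtain ⟨fb, hfb⟩ := exists_hom_dualNumber (K := K) b hb
    have hXa := G.map_mem fa hX
    have hYb := G.map_mem fb hY
    rw [map_onePlus fa _ _ a ha hfa] at hXa
    rw [map_onePlus fb _ _ b hb hfb] at hYb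
    have hc := (G.points R).mul_mem ((G.points R).mul_mem ((G.points R).mul_mem hXa hYb)
      ((G.points R).inv_mem hXa)) ((G.points R).inv_mem hYb)
    rw [onePlus_bracket a b ha hb hab, ← map_onePlus fc _ DualNumber.eps_mul_eps _ hab hfc] at hc
    intro p hp
    apply hinj
    rw [map_zero, ← aeval_map]
    exact hc p hp

variable {G} in
theorem conj_mem {g : GL (Fin n) K} (hg : g ∈ G.points K) {X : Matrix (Fin n) (Fin n) K}
    (hX : X ∈ G.lieAlg) :
    (g : Matrix (Fin n) (Fin n) K) * X * ((g⁻¹ : GL (Fin n) K) : Matrix (Fin n) (Fin n) K) ∈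
      G.lieAlg := by
  have h1 := G.map_mem (Algebra.ofId K K[ε]) hg
  have h2 := (G.points K[ε]).mul_mem ((G.points K[ε]).mul_mem h1 hX) ((G.points K[ε]).inv_mem h1)
  change onePlus _ _ _ ∈ G.points K[ε]
  convert h2 using 1
  rw [eq_mul_inv_iff_mul_eq]
  apply Units.ext
  have hc : ((Matrix.GeneralLinearGroup.map (Algebra.ofId K K[ε]).toRingHom g : GL (Fin n) K[ε]) :
      Matrix (Fin n) (Fin n) K[ε]) =
      (g : Matrix (Fin n) (Fin n) K).map (algebraMap K K[ε]) := by
    ext i j <;> rfl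
  simp only [onePlus, Units.val_mul, hc, add_mul, mul_add, one_mul, mul_one, Matrix.smul_mul,
    Matrix.mul_smul, ← Matrix.map_mul]
  simp [mul_assoc]

/-- The adjoint representation of `G(K)` on `𝔤`: `Ad g X = g X g⁻¹`. -/
def Ad : Representation K (G.points K) G.lieAlg where
  toFun g :=
    { toFun := fun X => ⟨(g.1 : Matrix (Fin n) (Fin n) K) * X.1 *
        ((g.1⁻¹ : GL (Fin n) K) : Matrix (Fin n) (Fin n) K), conj_mem g.2 X.2⟩
      map_add' := fun X Y => by
        ext1
        simp [mul_add, add_mul]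
      map_smul' := fun c X => by
        ext1
        simp }
  map_one' := by
    ext1 X
    ext1
    simp
  map_mul' g h := by
    ext1 X
    ext1
    simp [mul_assoc]

/-- The coadjoint representation of `G(K)` on `𝔤*`: `(Ad* g φ)(X) = φ(Ad g⁻¹ X)`. -/
def coAd : Representation K (G.points K) (Module.Dual K G.lieAlg) := G.Ad.dual

/-- The coadjoint action of `𝔤` on `𝔤*`: `(ad* X φ)(Y) = -φ([X, Y])`. -/
def coad (X : G.lieAlg) : Module.End K (Module.Dual K G.lieAlg) :=
  -(LieAlgebra.ad K G.lieAlg X).dualMap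

/-- The coadjoint `G(K)`-orbit of `φ`. -/
def orbit (φ : Module.Dual K G.lieAlg) : Set (Module.Dual K G.lieAlg) :=
  Set.range fun g : G.points K => G.coAd g φ

/-- `φ ∈ 𝔤*` is nilpotent: it is the Killing form pairing with a nilpotent element of `𝔤`. -/
def IsNilpotentFunctional (φ : Module.Dual K G.lieAlg) : Prop :=
  ∃ f : G.lieAlg, IsNilpotent (f : Matrix (Fin n) (Fin n) K) ∧ φ = killingForm K G.lieAlg f

/-- The nilpotent `K`-rational coadjoint orbits: the `G(K)`-orbits of nilpotent `φ ∈ 𝔤*`. -/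
def NilpotentOrbit : Type u :=
  {O : Set (Module.Dual K G.lieAlg) // ∃ φ, G.IsNilpotentFunctional φ ∧ O = G.orbit φ}

/-- `Z ∈ 𝔤` is rational semisimple: `Z` is a semisimple matrix, and all eigenvalues of `ad Z` (in an
algebraic closure of `K`) are rational numbers. -/
def IsRationalSemisimple [CharZero K] (Z : G.lieAlg) : Prop :=
  Module.End.IsSemisimple (Matrix.toLin' (Z : Matrix (Fin n) (Fin n) K)) ∧
    ∀ μ ∈ (LieAlgebra.ad K G.lieAlg Z).charpoly.aroots (AlgebraicClosure K),
      ∃ q : ℚ, μ = (q : AlgebraicClosure K)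

/-- `(𝔤*)^Z_q`, the `q`-eigenspace of `ad* Z` on `𝔤*`. -/
def dualEigenspace [CharZero K] (Z : G.lieAlg) (q : ℚ) : Submodule K (Module.Dual K G.lieAlg) :=
  (G.coad Z).eigenspace (q : K)

/-- `(𝔤*)^Z_{>0}`, the sum of the eigenspaces of `ad* Z` on `𝔤*` for positive eigenvalues. -/
def dualPos [CharZero K] (Z : G.lieAlg) : Submodule K (Module.Dual K G.lieAlg) :=
  ⨆ (q : ℚ) (_ : 0 < q), G.dualEigenspace Z q

/-- The relation `R` on nilpotent coadjoint orbits: `O ≠ O'`, and there are `φ ∈ O`, a rational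
semisimple `Z` and `φ' ∈ (𝔤*)^Z_{>0}` such that `φ ∈ (𝔤*)^Z_0` and `φ + φ' ∈ O'`. -/
def R [CharZero K] (O O' : G.NilpotentOrbit) : Prop :=
  O ≠ O' ∧ ∃ φ ∈ O.1, ∃ Z : G.lieAlg, G.IsRationalSemisimple Z ∧
    ∃ φ' ∈ G.dualPos Z, φ ∈ G.dualEigenspace Z 0 ∧ φ + φ' ∈ O'.1

end LinAlgGroup

/-! The dimension of the centralizer of `ad f` in `End 𝔤` depends only on the orbit of the Killing
pairing with `f`, and it drops strictly along `R`. This strict drop gives every claim.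

Write κ for the Killing form. After replacing `Z` by a positive multiple, `ad Z` has integral
eigenvalues and grades 𝔤. Then φ = κ(f) and φ + φ' = κ(f + x), where `ad f` has degree zero and x
has positive degree. Adding degree-raising terms to an operator cannot enlarge its kernel, so the
centralizer dimension does not grow. If it stays the same, `ad (f + x)` is conjugate to `ad f` by
some 1 + y in `End 𝔤`, with y of positive degree (`finrank_ker_commEnd_add_le`).

This conjugation need not come from the group. Still, if x lives in degrees at least k > 0, a trace
computation shows that κ(x, u) = 0 whenever u has degree -k and `ad ⁅u, f⁆ = 0`. By duality the
degree k part of κ(x) is u ↦ κ(f, ⁅w, u⁆) for some w of degree k (`exists_killingForm_lie_eq`). Such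
a w is a nilpotent matrix, exp w is a K-point of G, and acting by it removes the degree k part.
Finitely many steps carry φ + φ' to φ, so equal dimensions force equal orbits. The conjugating
elements are K-points throughout, so the argument applies directly to rational orbits.

Reductivity enters through one fact: the radical of κ is central. Over an algebraically closed
field, ⁅𝔤, rad κ⁆ consists of nilpotent matrices (Lie's theorem) and generates an associative
algebra B of nilpotent matrices (Engel). The intersection of G with 1 + B is closed, connected,
unipotent and normal, hence trivial; as it contains exp of ⁅𝔤, rad κ⁆, the latter is zero. The fact
descends to K because the Lie algebra and κ commute with extension of the base field. -/

/-! ### Filtrations by integral eigenvalues, and kernels of perturbed operators. -/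

namespace Module.End

variable {K : Type*} [Field K] {W W' : Type*} [AddCommGroup W] [Module K W]
  [AddCommGroup W'] [Module K W']

/-- The sum of the eigenspaces of `D` for integral eigenvalues at least `k`. -/
def weightGE (D : Module.End K W) (k : ℤ) : Submodule K W :=
  ⨆ (j : ℤ) (_ : k ≤ j), D.eigenspace (j : K)

theorem eigenspace_le_weightGE (D : Module.End K W) {k j : ℤ} (h : k ≤ j) :
    D.eigenspace (j : K) ≤ D.weightGE k :=
  le_iSup₂_of_le j h le_rfl

theorem weightGE_le {D : Module.End K W} {k : ℤ} {p : Submodule K W}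
    (h : ∀ j : ℤ, k ≤ j → D.eigenspace (j : K) ≤ p) : D.weightGE k ≤ p :=
  iSup₂_le h

theorem weightGE_antitone (D : Module.End K W) : Antitone D.weightGE := fun _ _ h =>
  weightGE_le fun _ hj => eigenspace_le_weightGE D (h.trans hj)

theorem weightGE_eq_sup (D : Module.End K W) (k : ℤ) :
    D.weightGE k = D.eigenspace (k : K) ⊔ D.weightGE (k + 1) := by
  refine le_antisymm (weightGE_le fun j hj => ?_)
    (sup_le (eigenspace_le_weightGE D le_rfl) (weightGE_antitone D (by lia)))
  rcases hj.eq_or_lt with rfl | h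
  · exact le_sup_left
  · exact (eigenspace_le_weightGE D h).trans le_sup_right

theorem weightGE_map_le {D : Module.End K W} {D' : Module.End K W'} {c : ℤ} (T : W →ₗ[K] W')
    (hT : ∀ (j : ℤ), ∀ y ∈ D.eigenspace (j : K), T y ∈ D'.weightGE (j + c)) {k : ℤ} {y : W}
    (hy : y ∈ D.weightGE k) : T y ∈ D'.weightGE (k + c) := by
  have h : D.weightGE k ≤ (D'.weightGE (k + c)).comap T := weightGE_le fun j hj y hy =>
    weightGE_antitone D' (by lia) (hT j y hy)
  exact h hy

variable [CharZero K]

theorem disjoint_eigenspace_weightGE (D : Module.End K W) {k j : ℤ} (h : k < j) :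
    Disjoint (D.eigenspace (k : K)) (D.weightGE j) := by
  refine (D.eigenspaces_iSupIndep (k : K)).mono_right (weightGE_le fun i hi => ?_)
  exact le_iSup₂_of_le (i : K) (by exact_mod_cast (h.trans_le hi).ne') le_rfl

variable [FiniteDimensional K W]

theorem exists_weightGE_eq (D : Module.End K W) :
    ∃ m : ℤ, D.weightGE m = ⊥ ∧ D.weightGE (-m) = ⨆ j : ℤ, D.eigenspace (j : K) := by
  have hfin : {k : ℤ | D.HasEigenvalue (k : K)}.Finite :=
    D.finite_hasEigenvalue.preimage (Int.cast_injective.injOn)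
  obtain ⟨a, ha⟩ := hfin.bddAbove
  obtain ⟨b, hb⟩ := hfin.bddBelow
  have h0 : ∀ j : ℤ, (a < j ∨ j < b) → D.eigenspace (j : K) = ⊥ := fun j hj => by
    by_contra h
    have h' : j ∈ {k : ℤ | D.HasEigenvalue (k : K)} := h
    have h1 := ha h'
    have h2 := hb h'
    lia
  refine ⟨max (a + 1) (-b), ?_, le_antisymm (weightGE_le fun j _ => le_iSup_of_le j le_rfl)
    (iSup_le fun j => ?_)⟩
  · rw [eq_bot_iff]
    exact weightGE_le fun j hj => (h0 j (by lia)).le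
  · by_cases hj : -max (a + 1) (-b) ≤ j
    · exact eigenspace_le_weightGE D hj
    · rw [h0 j (by lia)]
      exact bot_le

end Module.End

namespace Submodule

variable {K : Type*} [Field K] {W : Type*} [AddCommGroup W] [Module K W] [FiniteDimensional K W]

/-- Comparison of two subspaces whose leading terms with respect to a filtration are comparable. -/
theorem finrank_le_of_filtration {F : ℤ → Submodule K W} (hF : Antitone F) {a b : ℤ}
    (ha : F a = ⊤) (hb : F b = ⊥) {A B : Submodule K W}
    (h : ∀ k, A ⊓ F k ≤ (B ⊓ F k) ⊔ F (k + 1)) :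
    Module.finrank K A ≤ Module.finrank K B ∧
      (Module.finrank K A = Module.finrank K B → ∀ k, B ⊓ F k ≤ (A ⊓ F k) ⊔ F (k + 1)) := by
  -- The image of `C ⊓ F k` in the quotient of `F k` by `F (k + 1)` has dimension `dim (C ⊓ F k) -
  -- dim (C ⊓ F (k + 1))`.
  have key : ∀ (C : Submodule K W) (k : ℤ),
      Module.finrank K ↥((C ⊓ F k) ⊔ F (k + 1)) + Module.finrank K ↥(C ⊓ F (k + 1)) =
        Module.finrank K ↥(C ⊓ F k) + Module.finrank K ↥(F (k + 1)) := fun C k => by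
    have h1 := finrank_sup_add_finrank_inf_eq (C ⊓ F k) (F (k + 1))
    rwa [inf_assoc, inf_eq_right.mpr (hF (by lia : k ≤ k + 1))] at h1
  have hle : ∀ k, (A ⊓ F k) ⊔ F (k + 1) ≤ (B ⊓ F k) ⊔ F (k + 1) := fun k =>
    sup_le (h k) le_sup_right
  -- `φ` is antitone by `h`, is zero for large `k`, and equals `dim B - dim A` for small `k`. If the
  -- two end values agree it is constant, and each inclusion of graded pieces is an equality.
  set φ : ℤ → ℤ := fun k => Module.finrank K ↥(B ⊓ F k) - Module.finrank K ↥(A ⊓ F k) with hφ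
  have hanti : Antitone φ := antitone_int_of_succ_le fun k => by
    have h1 := finrank_mono (hle k)
    have h2 := key A k
    have h3 := key B k
    simp only [hφ]
    lia
  have htop : ∀ k ≤ a, φ k = Module.finrank K B - Module.finrank K A := fun k hk => by
    have : F k = ⊤ := top_le_iff.mp (ha ▸ hF hk)
    simp only [hφ]
    rw [this, inf_top_eq, inf_top_eq]
  have hbot : ∀ k, b ≤ k → φ k = 0 := fun k hk => by
    have : F k = ⊥ := le_bot_iff.mp (hb ▸ hF hk)
    simp only [hφ]
    rw [this, inf_bot_eq, inf_bot_eq, sub_self]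
  refine ⟨?_, fun heq k => ?_⟩
  · have h1 := hanti (le_max_left a b)
    rw [hbot _ (le_max_right a b), htop a le_rfl] at h1
    lia
  · have hz : ∀ k, φ k = 0 := fun k => by
      have h1 := hanti (min_le_left k a)
      have h2 := hanti (le_max_left k b)
      rw [htop _ (min_le_right k a)] at h1
      rw [hbot _ (le_max_right k b)] at h2
      lia
    have h1 := key A k
    have h2 := key B k
    have h3 := hz k
    have h4 := hz (k + 1)
    simp only [hφ] at h3 h4
    have := eq_of_le_of_finrank_eq (hle k) (by lia)
    rw [this]
    exact le_sup_left

end Submodule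

namespace Module.End

variable {K : Type*} [Field K] [CharZero K] {W : Type*} [AddCommGroup W] [Module K W]
  [FiniteDimensional K W]

/-- Perturbing a degree-preserving operator by one which raises degrees can only shrink the kernel,
and if the dimension is unchanged, all leading terms lift. -/
theorem finrank_ker_add_le {D : Module.End K W} (hD : ⨆ j : ℤ, D.eigenspace (j : K) = ⊤)
    {T S : Module.End K W}
    (hT : ∀ (j : ℤ), ∀ y ∈ D.eigenspace (j : K), T y ∈ D.eigenspace (j : K))
    (hS : ∀ (j : ℤ), ∀ y ∈ D.eigenspace (j : K), S y ∈ D.weightGE (j + 1)) :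
    Module.finrank K (LinearMap.ker (T + S)) ≤ Module.finrank K (LinearMap.ker T) ∧
      (Module.finrank K (LinearMap.ker (T + S)) = Module.finrank K (LinearMap.ker T) →
        ∀ k, ∀ y ∈ LinearMap.ker T, y ∈ D.weightGE k →
          ∃ z ∈ LinearMap.ker (T + S), z - y ∈ D.weightGE (k + 1)) := by
  obtain ⟨m, hm, hm'⟩ := D.exists_weightGE_eq
  have h := Submodule.finrank_le_of_filtration D.weightGE_antitone (hm'.trans hD) hm
    (A := LinearMap.ker (T + S)) (B := LinearMap.ker T) fun k y hy => ?_
  · refine ⟨h.1, fun heq k y hy hyk => ?_⟩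
    obtain ⟨z, hz, w, hw, rfl⟩ := Submodule.mem_sup.mp (h.2 heq k ⟨hy, hyk⟩)
    exact ⟨z, hz.1, by simpa using hw⟩
  · obtain ⟨hyT, hyk⟩ := Submodule.mem_inf.mp hy
    rw [weightGE_eq_sup] at hyk
    obtain ⟨z, hz, w, hw, rfl⟩ := Submodule.mem_sup.mp hyk
    refine Submodule.mem_sup.mpr ⟨z, ⟨?_, eigenspace_le_weightGE D le_rfl hz⟩, w, hw, rfl⟩
    have hTw : T w ∈ D.weightGE (k + 1) := by
      simpa using weightGE_map_le (c := 0) T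
        (fun j y hy => eigenspace_le_weightGE D (by lia) (hT j y hy)) hw
    have hSzw : S (z + w) ∈ D.weightGE (k + 1) := weightGE_map_le S hS
      (add_mem (eigenspace_le_weightGE D le_rfl hz) (weightGE_antitone D (by lia) hw))
    -- The leading term `z` of a kernel vector lies in the kernel of `T`: `T z` has degree exactly
    -- `k`, but also equals a sum of terms of higher degree.
    have hTz : T z = -(T w + S (z + w)) := by
      rw [eq_neg_iff_add_eq_zero, ← add_assoc, ← map_add]
      exact LinearMap.mem_ker.mp hyT
    exact LinearMap.mem_ker.mpr (Submodule.disjoint_def.mp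
      (disjoint_eigenspace_weightGE D (by lia : k < k + 1)) _ (hT k z hz)
      (hTz ▸ neg_mem (add_mem hTw hSzw)))

end Module.End

/-! ### Centralizers in `End V` under a perturbation of positive degree. -/

namespace Module.End

variable {K : Type*} [Field K] {V : Type*} [AddCommGroup V] [Module K V]

/-- The commutator with `D`, as an operator on `End V`. -/
def commEnd (D : Module.End K V) : Module.End K (Module.End K V) :=
  LinearMap.mulLeft K D - LinearMap.mulRight K D

theorem commEnd_apply (D Y : Module.End K V) : commEnd D Y = D * Y - Y * D := rfl

theorem mem_eigenspace_commEnd {D Y : Module.End K V} {k : ℤ} :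
    Y ∈ (commEnd D).eigenspace (k : K) ↔ D * Y - Y * D = (k : K) • Y :=
  Module.End.mem_eigenspace_iff

theorem mul_mem_weightGE_commEnd {D Y Y' : Module.End K V} {j k : ℤ}
    (hY : Y ∈ (commEnd D).weightGE j) (hY' : Y' ∈ (commEnd D).weightGE k) :
    Y * Y' ∈ (commEnd D).weightGE (j + k) := by
  refine weightGE_map_le (LinearMap.mulRight K Y') (fun i X hX => ?_) hY
  rw [add_comm]
  refine weightGE_map_le (LinearMap.mulLeft K X) (fun l X' hX' => ?_) hY'
  refine eigenspace_le_weightGE _ le_rfl ?_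
  rw [mem_eigenspace_commEnd] at *
  have : D * (X * X') - X * X' * D = (D * X - X * D) * X' + X * (D * X' - X' * D) := by
    noncomm_ring
  simp only [LinearMap.mulLeft_apply]
  rw [this, hX, hX', Int.cast_add, add_comm (l : K), add_smul]
  simp

/-- A commutator with `D` has trace zero, so an eigenvector of `commEnd D` with nonzero eigenvalue
has trace zero. -/
theorem trace_eq_zero_of_mem_weightGE_commEnd [CharZero K] {D Y : Module.End K V} {k : ℤ}
    (hk : 0 < k) (hY : Y ∈ (commEnd D).weightGE k) : LinearMap.trace K V Y = 0 := by
  refine (weightGE_le fun j hj X hX => ?_ :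
    (commEnd D).weightGE k ≤ LinearMap.ker (LinearMap.trace K V)) hY
  rw [mem_eigenspace_commEnd] at hX
  have h := congrArg (LinearMap.trace K V) hX
  rw [map_sub, LinearMap.trace_mul_comm, sub_self, map_smul, smul_eq_mul] at h
  exact (mul_eq_zero.mp h.symm).resolve_left (by exact_mod_cast (hk.trans_le hj).ne')

theorem eq_sum_coord_smulRight {ι : Type*} [Fintype ι] (b : Module.Basis ι K V)
    (Y : Module.End K V) : Y = ∑ i, (b.coord i).smulRight (Y (b i)) := by
  classical
  refine b.ext fun j => ?_
  simp [Finsupp.single_apply, ite_smul]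

theorem coord_comp_eigenbasis {ι : Type*} {D : Module.End K V} {b : Module.Basis ι K V}
    {d : ι → ℤ} (h : ∀ i, D (b i) = (d i : K) • b i) (i : ι) (v : V) :
    b.coord i (D v) = (d i : K) * b.coord i v := by
  classical
  have : (b.coord i) ∘ₗ D = (d i : K) • b.coord i := b.ext fun j => by
    by_cases hij : j = i
    · simp [h, hij]
    · simp [h, hij]
  exact LinearMap.congr_fun this v

theorem finrank_ker_commEnd_conj (e : V ≃ₗ[K] V) (f : Module.End K V) :
    Module.finrank K (LinearMap.ker (commEnd (e.conj f))) =
      Module.finrank K (LinearMap.ker (commEnd f)) := by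
  have h : LinearMap.ker (commEnd (e.conj f)) = (LinearMap.ker (commEnd f)).map
      (e.conj : Module.End K V →ₗ[K] Module.End K V) := by
    ext Y
    rw [Submodule.mem_map_equiv, LinearMap.mem_ker, LinearMap.mem_ker, commEnd_apply,
      commEnd_apply, sub_eq_zero, sub_eq_zero]
    constructor
    · intro h
      apply e.conj.injective
      simpa [Module.End.mul_eq_comp, LinearEquiv.conj_comp] using h
    · intro h
      apply e.conj.symm.injective
      apply e.conj.injective
      have h' := congrArg e.conj h
      simpa [Module.End.mul_eq_comp, LinearEquiv.conj_comp] using h'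
  rw [h]
  exact LinearEquiv.finrank_map_eq _ _

variable [FiniteDimensional K V]

theorem exists_eigenbasis {D : Module.End K V} (hD : ⨆ j : ℤ, D.eigenspace (j : K) = ⊤) :
    ∃ (s : Set V) (_ : Fintype s) (b : Module.Basis s K V) (d : s → ℤ),
      ∀ i, D (b i) = (d i : K) • b i := by
  have hs : ⊤ ≤ Submodule.span K {v : V | ∃ j : ℤ, v ∈ D.eigenspace (j : K)} := by
    rw [← hD]
    exact iSup_le fun j v hv => Submodule.subset_span ⟨j, hv⟩
  let b := Module.Basis.ofSpan hs
  have hb : ∀ i, ∃ j : ℤ, b i ∈ D.eigenspace (j : K) := fun i =>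
    Module.Basis.ofSpan_subset hs ⟨i, rfl⟩
  choose d hd using hb
  exact ⟨_, FiniteDimensional.fintypeBasisIndex b, b, d, fun i =>
    Module.End.mem_eigenspace_iff.mp (hd i)⟩

/-- Rank-one operators built from an eigenbasis of `D` are eigenvectors. The sign in `-D` is chosen
so that right multiplication by an operator of positive commutator degree raises this degree too. -/
theorem iSup_eigenspace_mulRight {D : Module.End K V}
    (hD : ⨆ j : ℤ, D.eigenspace (j : K) = ⊤) :
    ⨆ j : ℤ, Module.End.eigenspace (LinearMap.mulRight K (-D)) (j : K) = ⊤ := by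
  obtain ⟨s, _, b, d, hb⟩ := exists_eigenbasis hD
  refine eq_top_iff.mpr fun Y _ => ?_
  rw [eq_sum_coord_smulRight b Y]
  refine sum_mem fun i _ => Submodule.mem_iSup_of_mem (-d i) ?_
  rw [Module.End.mem_eigenspace_iff]
  ext v
  have := coord_comp_eigenbasis hb i v
  simp only [Module.Basis.coord_apply] at this
  simp [this, mul_smul]

theorem iSup_eigenspace_commEnd {D : Module.End K V}
    (hD : ⨆ j : ℤ, D.eigenspace (j : K) = ⊤) :
    ⨆ j : ℤ, (commEnd D).eigenspace (j : K) = ⊤ := by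
  obtain ⟨s, _, b, d, hb⟩ := exists_eigenbasis hD
  refine eq_top_iff.mpr fun Y _ => ?_
  rw [eq_sum_coord_smulRight b Y]
  refine sum_mem fun i _ => ?_
  generalize Y (b i) = v
  have hv : v ∈ ⨆ j : ℤ, D.eigenspace (j : K) := hD ▸ Submodule.mem_top
  refine (iSup_le fun j w hw => ?_ : ⨆ j : ℤ, D.eigenspace (j : K) ≤
    (⨆ j : ℤ, (commEnd D).eigenspace (j : K)).comap
      (LinearMap.smulRightₗ (b.coord i))) hv
  refine Submodule.mem_iSup_of_mem (j - d i) ?_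
  rw [mem_eigenspace_commEnd]
  ext u
  have := coord_comp_eigenbasis hb i u
  simp only [Module.Basis.coord_apply] at this
  rw [Module.End.mem_eigenspace_iff] at hw
  simp [this, hw, sub_smul, mul_smul, smul_comm (j : K)]

variable [CharZero K]

/-- If `f` has degree zero and `X` has positive degree, then the centralizer of `f + X` is at most
as large as that of `f`; in case of equality, `f + X` is conjugate to `f` by an
element of the form `1 + y` with `y` of positive degree. -/
theorem finrank_ker_commEnd_add_le {D f X : Module.End K V}
    (hD : ⨆ j : ℤ, D.eigenspace (j : K) = ⊤) (hf : Commute D f)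
    (hX : X ∈ (commEnd D).weightGE 1) :
    Module.finrank K (LinearMap.ker (commEnd (f + X))) ≤
        Module.finrank K (LinearMap.ker (commEnd f)) ∧
      (Module.finrank K (LinearMap.ker (commEnd (f + X))) =
          Module.finrank K (LinearMap.ker (commEnd f)) →
        ∃ y ∈ (commEnd D).weightGE 1, (f + X) * (1 + y) = (1 + y) * f) := by
  -- The operator `Y ↦ (f + X) Y - Y f` stands between the two commutators: grading by `Y ↦ -Y D`
  -- bounds the kernel of `commEnd (f + X)` by that of `T`, and grading by `commEnd D` bounds the
  -- kernel of `T` by that of `commEnd f`. The detour is needed because elements of `ker T` are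
  -- intertwiners, whereas lifting `1` directly to `ker (commEnd (f + X))` gives no information.
  set T : Module.End K (Module.End K V) :=
    LinearMap.mulLeft K (f + X) - LinearMap.mulRight K f with hT
  have h1 : commEnd (f + X) = T + -LinearMap.mulRight K X := by
    ext1 Y
    simp [commEnd_apply, hT, mul_add]
    abel
  have h2 : T = commEnd f + LinearMap.mulLeft K X := by
    ext1 Y
    simp [commEnd_apply, hT, add_mul]
    abel
  have hle1 := finrank_ker_add_le (iSup_eigenspace_mulRight hD) (T := T)
    (S := -LinearMap.mulRight K X) (fun j y hy => by
      rw [Module.End.mem_eigenspace_iff] at *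
      simp only [hT, LinearMap.sub_apply, LinearMap.mulLeft_apply, LinearMap.mulRight_apply] at *
      rw [sub_mul, smul_sub, mul_assoc, hy, mul_assoc y, ((hf.symm).neg_right).eq, ← mul_assoc, hy]
      simp) (fun j y hy => by
      rw [add_comm]
      refine weightGE_map_le (-LinearMap.mulLeft K y) (fun i Y hY => ?_) hX
      refine eigenspace_le_weightGE _ le_rfl ?_
      rw [mem_eigenspace_commEnd] at hY
      rw [Module.End.mem_eigenspace_iff] at *
      simp only [LinearMap.neg_apply, LinearMap.mulLeft_apply, LinearMap.mulRight_apply] at *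
      have hY' : Y * -D = (i : K) • Y + -D * Y := by
        rw [← hY]
        noncomm_ring
      rw [neg_mul, mul_assoc, hY', mul_add, ← mul_assoc, hy]
      simp [add_smul])
  have hle2 := finrank_ker_add_le (iSup_eigenspace_commEnd hD) (T := commEnd f)
    (S := LinearMap.mulLeft K X) (fun j y hy => by
      rw [mem_eigenspace_commEnd] at *
      rw [commEnd_apply, smul_sub, ← mul_smul_comm, ← smul_mul_assoc, ← hy]
      have h := hf.eq
      have e1 : D * (f * y - y * f) - (f * y - y * f) * D =
        (D * f) * y - D * y * f - f * y * D + y * (f * D) := by noncomm_ring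
      have e2 : f * (D * y - y * D) - (D * y - y * D) * f =
        (f * D) * y - D * y * f - f * y * D + y * (D * f) := by noncomm_ring
      rw [e1, e2, h]) (fun j y hy => by
      rw [add_comm]
      exact mul_mem_weightGE_commEnd hX (eigenspace_le_weightGE _ le_rfl hy))
  rw [← h1] at hle1
  rw [← h2] at hle2
  refine ⟨hle1.1.trans hle2.1, fun heq => ?_⟩
  -- Equality of the outer dimensions forces equality in the second comparison, so the degree zero
  -- element `1` of `ker (commEnd f)` lifts to `ker T`.
  obtain ⟨z, hz, hz1⟩ := hle2.2 (le_antisymm hle2.1 (heq ▸ hle1.1)) 0 1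
    (by simp [commEnd_apply]) (eigenspace_le_weightGE _ le_rfl
      (mem_eigenspace_commEnd.mpr (by simp)))
  refine ⟨z - 1, by simpa using hz1, ?_⟩
  rw [add_sub_cancel]
  simpa [hT, sub_eq_zero] using hz

end Module.End

/-! ### The grading of a Lie algebra by `ad Z`, and the infinitesimal step. -/

namespace LieAlgebra

open Module.End

variable {K : Type*} [Field K] {L : Type*} [LieRing L] [LieAlgebra K L]

theorem lie_mem_weightGE {Z x y : L} {j k : ℤ} (hx : x ∈ (ad K L Z).weightGE j)
    (hy : y ∈ (ad K L Z).weightGE k) : ⁅x, y⁆ ∈ (ad K L Z).weightGE (j + k) := by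
  have h : ⁅x, y⁆ = (ad K L).toLinearMap.flip y x := by simp
  rw [h]
  refine weightGE_map_le _ (fun i X hX => ?_) hx
  rw [add_comm]
  refine weightGE_map_le (ad K L X) (fun l X' hX' => eigenspace_le_weightGE _ le_rfl ?_) hy
  rw [Module.End.mem_eigenspace_iff, ad_apply] at *
  rw [ad_apply, leibniz_lie, hX, hX']
  simp [add_smul, add_comm]

theorem ad_mem_weightGE {Z x : L} {k : ℤ} (hx : x ∈ (ad K L Z).weightGE k) :
    ad K L x ∈ (commEnd (ad K L Z)).weightGE k := by
  have := weightGE_map_le (c := 0) (D' := commEnd (ad K L Z)) (ad K L).toLinearMap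
    (fun j y hy => eigenspace_le_weightGE _ (add_zero j).le ?_) hx
  · simpa using this
  rw [mem_eigenspace_commEnd]
  rw [Module.End.mem_eigenspace_iff, ad_apply] at hy
  have h : ad K L Z * ad K L y - ad K L y * ad K L Z = ⁅ad K L Z, ad K L y⁆ := rfl
  change ad K L Z * ad K L y - ad K L y * ad K L Z = (j : K) • ad K L y
  rw [h, ← LieHom.map_lie, hy]
  exact map_smul (ad K L).toLinearMap _ _

theorem eq_zero_of_mem_weightGE_of_lie_eq_zero [CharZero K] {Z : L} {ψ : Module.Dual K L}
    (h : ∀ y, ψ ⁅Z, y⁆ = 0) {k : ℤ} (hk : 0 < k) {y : L}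
    (hy : y ∈ (ad K L Z).weightGE k) : ψ y = 0 := by
  refine (weightGE_le fun j hj X hX => ?_ : (ad K L Z).weightGE k ≤ LinearMap.ker ψ) hy
  rw [Module.End.mem_eigenspace_iff, ad_apply] at hX
  have h1 := h X
  rw [hX, map_smul, smul_eq_mul] at h1
  exact (mul_eq_zero.mp h1).resolve_left (by exact_mod_cast (hk.trans_le hj).ne')

/-- In finite dimensions a subspace of the dual is the annihilator of its own annihilator. -/
theorem mem_range_of_forall_flip_eq_zero {A B : Type*} [AddCommGroup A] [Module K A]
    [AddCommGroup B] [Module K B] [FiniteDimensional K A] [FiniteDimensional K B]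
    (β : A →ₗ[K] Module.Dual K B)
    (ψ : Module.Dual K B) (h : ∀ u, (∀ w, β w u = 0) → ψ u = 0) : ∃ w, β w = ψ := by
  have h1 : ψ ∈ (LinearMap.range β).dualCoannihilator.dualAnnihilator := by
    rw [Submodule.mem_dualAnnihilator]
    intro u hu
    rw [Submodule.mem_dualCoannihilator] at hu
    exact h u fun w => hu _ ⟨w, rfl⟩
  rw [Subspace.dualCoannihilator_dualAnnihilator_eq] at h1
  exact h1

theorem finrank_ker_commEnd_ad_equiv (e : L ≃ₗ⁅K⁆ L) (f : L) :
    Module.finrank K (LinearMap.ker (commEnd (ad K L (e f)))) =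
      Module.finrank K (LinearMap.ker (commEnd (ad K L f))) := by
  rw [← conj_ad_apply]
  exact finrank_ker_commEnd_conj _ _

/-- By invariance `⁅Z, f⁆` lies in the radical of the Killing form, which `hrad` makes central. Thus
`ad f` has degree zero even if `⁅Z, f⁆ ≠ 0`. -/
theorem commute_ad_of_killingForm {Z f : L} (hrad : ∀ x : L, killingForm K L x = 0 → ad K L x = 0)
    (hf : ∀ y, killingForm K L f ⁅Z, y⁆ = 0) : Commute (ad K L Z) (ad K L f) := by
  have h : ad K L ⁅Z, f⁆ = 0 := hrad _ <| by
    ext y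
    rw [← lie_skew, map_neg, LinearMap.neg_apply, LieModule.traceForm_apply_lie_apply, hf]
    simp
  rw [LieHom.map_lie] at h
  exact sub_eq_zero.mp h

theorem killingForm_eq_zero_of_mem_weightGE [CharZero K] {Z x y : L} {j k : ℤ} (h : 0 < j + k)
    (hx : x ∈ (ad K L Z).weightGE j) (hy : y ∈ (ad K L Z).weightGE k) :
    killingForm K L x y = 0 := by
  rw [killingForm_apply_apply]
  exact trace_eq_zero_of_mem_weightGE_commEnd h
    (mul_mem_weightGE_commEnd (ad_mem_weightGE hx) (ad_mem_weightGE hy))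

variable [CharZero K] [FiniteDimensional K L]

variable {Z f x : L} (hrad : ∀ x : L, killingForm K L x = 0 → ad K L x = 0)
  (hZ : ⨆ j : ℤ, (ad K L Z).eigenspace (j : K) = ⊤)
  (hf : ∀ y, killingForm K L f ⁅Z, y⁆ = 0)

include hrad hZ hf

theorem killingForm_eq_zero_of_finrank_eq {k : ℤ} (hk : 0 < k)
    (hx : x ∈ (ad K L Z).weightGE k)
    (heq : Module.finrank K (LinearMap.ker (commEnd (ad K L (f + x)))) =
      Module.finrank K (LinearMap.ker (commEnd (ad K L f))))
    {u : L} (hu : u ∈ (ad K L Z).weightGE (-k)) (huf : ad K L ⁅u, f⁆ = 0) :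
    killingForm K L x u = 0 := by
  have hX := ad_mem_weightGE hx
  rw [map_add] at heq
  obtain ⟨y, hy, hyf⟩ := (finrank_ker_commEnd_add_le hZ (commute_ad_of_killingForm hrad hf)
    (weightGE_antitone _ (by lia) hX)).2 heq
  have hcomm : ad K L u * ad K L f = ad K L f * ad K L u := by
    rw [LieHom.map_lie] at huf
    exact sub_eq_zero.mp huf
  -- Expanding the intertwining relation writes `ad x` as a commutator with `ad f` plus an error of
  -- degree at least `k + 1`. Against `ad u`, which commutes with `ad f`, the commutator has trace
  -- zero, and the error has positive degree.
  have hxy : ad K L x = y * ad K L f - ad K L f * y - ad K L x * y := by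
    have h2 : ad K L x = (ad K L f + ad K L x) * (1 + y) - ad K L f - ad K L f * y -
      ad K L x * y := by noncomm_ring
    rw [hyf] at h2
    exact h2.trans (by noncomm_ring)
  have h0 : LinearMap.trace K L (ad K L x * y * ad K L u) = 0 :=
    trace_eq_zero_of_mem_weightGE_commEnd (by lia : 0 < k + 1 + -k)
      (mul_mem_weightGE_commEnd (mul_mem_weightGE_commEnd hX hy) (ad_mem_weightGE hu))
  rw [killingForm_apply_apply, ← Module.End.mul_eq_comp, hxy, sub_mul, sub_mul, map_sub, map_sub,
    h0, sub_zero, mul_assoc, ← hcomm, ← mul_assoc, LinearMap.trace_mul_cycle, sub_self]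

/-- The infinitesimal step: the lowest degree part of `killingForm x` is tangent to the coadjoint
orbit of `killingForm f`. -/
theorem exists_killingForm_lie_eq {k : ℤ} (hk : 0 < k)
    (hx : x ∈ (ad K L Z).weightGE k)
    (heq : Module.finrank K (LinearMap.ker (commEnd (ad K L (f + x)))) =
      Module.finrank K (LinearMap.ker (commEnd (ad K L f)))) :
    ∃ w ∈ (ad K L Z).eigenspace (k : K), ∀ u ∈ (ad K L Z).weightGE (-k),
      killingForm K L x u = killingForm K L f ⁅w, u⁆ := by
  set A := (ad K L Z).eigenspace (k : K) with hA
  set B := (ad K L Z).eigenspace ((-k : ℤ) : K) with hB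
  let β : A →ₗ[K] Module.Dual K B :=
    (((ad K L).toLinearMap.compr₂ (killingForm K L f)).domRestrict₁₂ A B)
  have hβ : ∀ w u, β w u = killingForm K L f ⁅(w : L), (u : L)⁆ := fun w u => rfl
  obtain ⟨w, hw⟩ := mem_range_of_forall_flip_eq_zero β ((killingForm K L x).domRestrict B)
    fun u hu => by
      refine killingForm_eq_zero_of_finrank_eq hrad hZ hf hk hx heq
        (eigenspace_le_weightGE _ le_rfl u.2) (hrad _ ?_)
      ext w
      have hw : w ∈ ⨆ j : ℤ, (ad K L Z).eigenspace (j : K) := hZ ▸ Submodule.mem_top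
      refine (iSup_le fun j v hv => ?_ : ⨆ j : ℤ, (ad K L Z).eigenspace (j : K) ≤
        LinearMap.ker (killingForm K L ⁅(u : L), f⁆)) hw
      have e : killingForm K L ⁅(u : L), f⁆ v = killingForm K L f ⁅v, (u : L)⁆ := by
        rw [← lie_skew, map_neg, LinearMap.neg_apply, LieModule.traceForm_apply_lie_apply,
          ← lie_skew, map_neg, neg_neg]
      rw [LinearMap.mem_ker, e]
      -- Only `j = k` uses the choice of `u`; otherwise `⁅v, u⁆` has the nonzero degree `j - k`, on
      -- which the Killing pairing with `f` vanishes.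
      by_cases hj : j = k
      · subst hj
        exact hu ⟨v, hv⟩
      · have hu' := Module.End.mem_eigenspace_iff.mp u.2
        rw [ad_apply] at hu'
        rw [Module.End.mem_eigenspace_iff, ad_apply] at hv
        have h1 := hf ⁅v, (u : L)⁆
        rw [leibniz_lie, hv, hu', smul_lie, lie_smul, ← add_smul, map_smul, smul_eq_mul] at h1
        refine (mul_eq_zero.mp h1).resolve_left ?_
        rw [← Int.cast_add]
        exact_mod_cast (by lia : j + -k ≠ 0)
  refine ⟨w, w.2, fun u hu => ?_⟩
  rw [weightGE_eq_sup] at hu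
  obtain ⟨u₁, hu₁, u₂, hu₂, rfl⟩ := Submodule.mem_sup.mp hu
  have h1 : killingForm K L x u₁ = killingForm K L f ⁅(w : L), u₁⁆ :=
    (LinearMap.congr_fun hw ⟨u₁, hu₁⟩).symm
  have h2 : killingForm K L x u₂ = 0 := killingForm_eq_zero_of_mem_weightGE (by lia) hx hu₂
  have h3 : killingForm K L f ⁅(w : L), u₂⁆ = 0 :=
    eq_zero_of_mem_weightGE_of_lie_eq_zero hf (by lia : 0 < k + (-k + 1))
      (lie_mem_weightGE (eigenspace_le_weightGE _ le_rfl w.2) hu₂)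
  rw [map_add, lie_add, map_add, h1, h2, h3]

end LieAlgebra

/-! ### Exponentials of nilpotent elements of the Lie algebra. -/

theorem IsNilpotent.eq_zero_of_exp_eq_one {A : Type*} [Ring A] [Algebra ℚ A] {a : A}
    (ha : IsNilpotent a) (h : IsNilpotent.exp a = 1) : a = 0 := by
  by_contra h0
  have : Nontrivial A := nontrivial_of_ne _ _ h0
  obtain ⟨r, hr⟩ : ∃ r, nilpotencyClass a = r + 2 := by
    have h1 := pos_nilpotencyClass_iff.mpr ha
    have h2 : nilpotencyClass a ≠ 1 := fun h => h0 (by simpa using h)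
    exact ⟨nilpotencyClass a - 2, by lia⟩
  have hz : a ^ (r + 2) = 0 := hr ▸ pow_nilpotencyClass ha
  rw [IsNilpotent.exp_eq_sum hz, Finset.sum_range_succ', Finset.sum_range_succ'] at h
  -- Only `a ^ r + a ^ (r + 1)` survives on the left, so `a ^ (r + 1) = 0`, against the nilpotency
  -- class `r + 2`.
  have h' := congrArg (a ^ r * ·) h
  have hsum : a ^ r * ∑ i ∈ Finset.range r, ((i + 1 + 1).factorial : ℚ)⁻¹ • a ^ (i + 1 + 1) = 0 := by
    rw [Finset.mul_sum]
    refine Finset.sum_eq_zero fun i _ => ?_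
    rw [mul_smul_comm, ← pow_add, pow_eq_zero_of_le (by lia) hz, smul_zero]
  simp only [mul_add, hsum] at h'
  have h1 : a ^ (r + 1) = 0 := by
    rw [_root_.pow_succ]
    simpa using h'
  have h2 : nilpotencyClass a ≤ r + 1 := Nat.sInf_le h1
  lia

namespace Polynomial

theorem eq_zero_of_iterate_derivative_eval_zero {K : Type*} [Field K] [CharZero K] {Q : K[X]}
    (h : ∀ j, (derivative^[j] Q).eval 0 = 0) : Q = 0 := by
  ext j
  have hj := h j
  rw [← coeff_zero_eq_eval_zero, coeff_iterate_derivative, zero_add, Nat.descFactorial_self,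
    nsmul_eq_mul] at hj
  exact (mul_eq_zero.mp hj).resolve_left (by exact_mod_cast j.factorial_ne_zero)

end Polynomial

namespace Matrix

variable {K : Type u} [Field K] [CharZero K] {n : ℕ}

open Polynomial in
/-- The one-parameter subgroup `exp (T X)` of a nilpotent matrix `X`, over the polynomial ring. -/
theorem exists_expPoly {X : Matrix (Fin n) (Fin n) K} (hX : IsNilpotent X) :
    ∃ E : GL (Fin n) K[X],
      (E : Matrix (Fin n) (Fin n) K[X]).map (aeval (0 : K)) = 1 ∧
      (E : Matrix (Fin n) (Fin n) K[X]).map (aeval (1 : K)) = IsNilpotent.exp X ∧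
      ∀ i j, derivative ((E : Matrix (Fin n) (Fin n) K[X]) i j) =
        ((E : Matrix (Fin n) (Fin n) K[X]) * X.map C) i j := by
  obtain ⟨M, hM⟩ := hX
  have hM1 : X ^ (M + 1) = 0 := by rw [pow_succ, hM, zero_mul]
  set Y : Matrix (Fin n) (Fin n) K[X] := (Polynomial.X : K[X]) • C.mapMatrix X with hY
  have hYpow : ∀ i, Y ^ i = (Polynomial.X ^ i : K[X]) • C.mapMatrix (X ^ i) := fun i => by
    rw [hY, _root_.smul_pow, ← map_pow]
  have hYM : Y ^ (M + 1) = 0 := by rw [hYpow, hM1, map_zero, smul_zero]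
  have hYn : IsNilpotent Y := ⟨_, hYM⟩
  have hmap : ∀ a : K, (IsNilpotent.exp Y).map (aeval a) = IsNilpotent.exp (a • X) := fun a => by
    have h := IsNilpotent.map_exp hYn (aeval a : K[X] →ₐ[K] K).toRingHom.mapMatrix
    have h2 : (aeval a : K[X] →ₐ[K] K).toRingHom.mapMatrix Y = a • X := by
      ext i j
      simp [hY]
      ring
    rw [h2] at h
    exact h
  refine ⟨⟨IsNilpotent.exp Y, IsNilpotent.exp (-Y), IsNilpotent.exp_mul_exp_neg_self hYn,
    IsNilpotent.exp_neg_mul_exp_self hYn⟩, ?_, ?_, fun i j => ?_⟩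
  · exact (hmap 0).trans (by rw [zero_smul, IsNilpotent.exp_zero])
  · exact (hmap 1).trans (by rw [one_smul])
  · simp only
    have hsum : IsNilpotent.exp Y = ∑ i ∈ Finset.range (M + 1),
        ((C (i.factorial : K)⁻¹ * Polynomial.X ^ i : K[X]) • C.mapMatrix (X ^ i)) := by
      rw [IsNilpotent.exp_eq_sum hYM]
      refine Finset.sum_congr rfl fun i _ => ?_
      rw [hYpow, mul_smul]
      generalize (Polynomial.X ^ i : K[X]) • C.mapMatrix (X ^ i) = A
      ext a b k
      have h1 : (((i.factorial : ℚ)⁻¹ • A) a b).coeff k =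
        (i.factorial : ℚ)⁻¹ • (A a b).coeff k := rfl
      rw [h1, Matrix.smul_apply, smul_eq_mul, coeff_C_mul, Algebra.smul_def]
      simp
    have hXC : X.map C = C.mapMatrix X := rfl
    rw [hsum, Finset.sum_mul, Finset.sum_range_succ', Finset.sum_range_succ (n := M), hXC]
    simp only [smul_mul_assoc, ← map_mul, ← pow_succ]
    rw [hM1]
    simp only [map_zero, smul_zero, Matrix.zero_apply, Matrix.add_apply, Matrix.sum_apply, derivative_add,
      derivative_sum, Matrix.smul_apply, smul_eq_mul, RingHom.mapMatrix_apply, Matrix.map_apply]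
    have h0 : derivative (C ((Nat.factorial 0 : ℕ) : K)⁻¹ * Polynomial.X ^ 0 *
        C ((X ^ 0) i j)) = 0 := by simp
    rw [h0, add_zero, add_zero]
    refine Finset.sum_congr rfl fun k _ => ?_
    rw [derivative_mul, derivative_C, mul_zero, add_zero, derivative_C_mul, derivative_X_pow,
      Nat.factorial_succ, Nat.add_sub_cancel, ← mul_assoc, ← C_mul]
    congr 3
    push_cast
    field_simp

end Matrix

namespace LinAlgGroup

variable {K : Type u} [Field K] {n : ℕ} (G : LinAlgGroup K n)

theorem onePlus_mem {X : Matrix (Fin n) (Fin n) K} (hX : X ∈ G.lieAlg) {R : Type u} [CommRing R]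
    [Algebra K R] (r : R) (hr : r * r = 0) : onePlus r hr X ∈ G.points R := by
  obtain ⟨f, hf⟩ := exists_hom_dualNumber (K := K) r hr
  rw [← map_onePlus f _ DualNumber.eps_mul_eps r hr hf]
  exact G.map_mem f hX

open Polynomial in
/-- A curve in `GL n` over `K[T]` through `1` with velocity in the Lie algebra of `G` lies in `G`
to all finite orders. -/
theorem exists_truncation {X : Matrix (Fin n) (Fin n) K} (hX : X ∈ G.lieAlg) (E : GL (Fin n) K[X])
    (hE0 : (E : Matrix (Fin n) (Fin n) K[X]).map (aeval (0 : K)) = 1)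
    (hE : ∀ i j, derivative ((E : Matrix (Fin n) (Fin n) K[X]) i j) =
      ((E : Matrix (Fin n) (Fin n) K[X]) * X.map C) i j) (m : ℕ) :
    ∃ (R : Type u) (_ : CommRing R) (_ : Algebra K R) (s : R),
      Matrix.GeneralLinearGroup.map (aeval s : K[X] →ₐ[K] R).toRingHom E ∈ G.points R ∧
      ∀ Q : K[X], aeval s Q = 0 → ∀ j ≤ m, (derivative^[j] Q).eval 0 = 0 := by
  induction m with
  | zero =>
    refine ⟨K, inferInstance, inferInstance, 0, ?_, fun Q hQ j hj => ?_⟩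
    · have : Matrix.GeneralLinearGroup.map (aeval (0 : K) : K[X] →ₐ[K] K).toRingHom E = 1 :=
        Units.ext hE0
      rw [this]
      exact (G.points K).one_mem
    · rw [Nat.le_zero.mp hj]
      simpa [coe_aeval_eq_eval] using hQ
  | succ m ih =>
    obtain ⟨R, _, _, s, hs, hQ⟩ := ih
    have hsq : (DualNumber.eps : R[ε]) ^ 2 = 0 := by rw [pow_two, DualNumber.eps_mul_eps]
    have haeval : ∀ Q : K[X], aeval (TrivSqZeroExt.inl s + DualNumber.eps : R[ε]) Q =
        TrivSqZeroExt.inl (aeval s Q) + TrivSqZeroExt.inl (aeval s (derivative Q)) *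
          DualNumber.eps := fun Q => by
      have h : ∀ Q : K[X], aeval (TrivSqZeroExt.inl s : R[ε]) Q = TrivSqZeroExt.inl (aeval s Q) :=
        fun Q => aeval_algHom_apply (TrivSqZeroExt.inlAlgHom K R R) s Q
      rw [aeval_add_of_sq_eq_zero _ _ _ hsq, h, h]
    -- Each order of vanishing costs one new infinitesimal: `E(s + ε) = E(s) + ε E'(s) = E(s) (1 + ε
    -- X)`, a product of two points of `G`.
    refine ⟨R[ε], inferInstance, inferInstance, TrivSqZeroExt.inl s + DualNumber.eps, ?_,
      fun Q h j hj => ?_⟩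
    · have hmem := (G.points R[ε]).mul_mem (G.map_mem (TrivSqZeroExt.inlAlgHom K R R) hs)
        (G.onePlus_mem hX (DualNumber.eps : R[ε]) DualNumber.eps_mul_eps)
      convert hmem using 1
      apply Units.ext
      ext1 i j
      have h1 := haeval ((E : Matrix (Fin n) (Fin n) K[X]) i j)
      rw [hE] at h1
      refine h1.trans ?_
      rw [Units.val_mul]
      simp only [onePlus, mul_add, mul_one, Matrix.mul_smul, Matrix.add_apply, Matrix.smul_apply]
      congr 1
      rw [Matrix.mul_apply, Matrix.mul_apply, map_sum, smul_eq_mul, mul_comm]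
      congr 1
      change TrivSqZeroExt.inlHom R R _ = _
      rw [map_sum]
      refine Finset.sum_congr rfl fun k _ => ?_
      simp only [map_mul, Matrix.map_apply, aeval_C]
      rfl
    · rw [haeval] at h
      have h1 : aeval s Q = 0 := by simpa using congrArg TrivSqZeroExt.fst h
      have h2 : aeval s (derivative Q) = 0 := by simpa using congrArg TrivSqZeroExt.snd h
      rcases Nat.eq_zero_or_eq_succ_pred j with h0 | h0
      · rw [h0]
        exact hQ Q h1 0 (Nat.zero_le _)
      · rw [h0, Function.iterate_succ_apply]
        exact hQ _ h2 _ (by lia)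

open Polynomial in
/-- The exponential of a nilpotent element of the Lie algebra is a point of the group. -/
theorem exists_mem_points_eq_exp [CharZero K] {X : Matrix (Fin n) (Fin n) K} (hX : X ∈ G.lieAlg)
    (hn : IsNilpotent X) :
    ∃ g ∈ G.points K, (g : Matrix (Fin n) (Fin n) K) = IsNilpotent.exp X := by
  obtain ⟨E, hE0, hE1, hE⟩ := Matrix.exists_expPoly hn
  refine ⟨Matrix.GeneralLinearGroup.map (aeval (1 : K) : K[X] →ₐ[K] K).toRingHom E,
    fun p hp => ?_, hE1⟩
  -- Membership to every finite order makes all derivatives at `0` of this one-variable polynomial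
  -- vanish, so it is zero and may be evaluated at `1`.
  have hP : MvPolynomial.aeval (fun ij => (E : Matrix (Fin n) (Fin n) K[X]) ij.1 ij.2) p = 0 := by
    refine eq_zero_of_iterate_derivative_eval_zero fun j => ?_
    obtain ⟨R, _, _, s, hs, hQ⟩ := G.exists_truncation hX E hE0 hE j
    refine hQ _ ?_ j le_rfl
    rw [← aeval_map]
    exact hs p hp
  have h := aeval_map (aeval (1 : K) : K[X] →ₐ[K] K) (E : Matrix (Fin n) (Fin n) K[X]) p
  rw [hP, map_zero] at h
  exact h

end LinAlgGroup

/-! ### Connectedness of unipotent groups. -/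

open Polynomial in
theorem Matrix.exists_powPoly {F : Type u} [Field F] [CharZero F] {n : ℕ}
    {u : Matrix (Fin n) (Fin n) F} (hu : IsNilpotent (u - 1)) :
    ∃ E : Fin n → Fin n → F[X], ∀ (k : ℕ) (i j), (E i j).eval (k : F) = (u ^ k) i j := by
  obtain ⟨r, hr⟩ := hu
  set N := u - 1 with hN
  refine ⟨fun i j => ∑ l ∈ Finset.range r,
    C (((l.factorial : F)⁻¹) * (N ^ l) i j) * descPochhammer F l, fun k i j => ?_⟩
  -- Expand `(1 + N) ^ k`; the sum stops at `r`, and each binomial coefficient is a polynomial in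
  -- `k`.
  have h1 : u ^ k = ∑ l ∈ Finset.range r, (k.choose l : F) • N ^ l := by
    have hu : u = N + 1 := by rw [hN, sub_add_cancel]
    rw [hu, (Commute.one_right N).add_pow]
    have e : ∀ l, N ^ l * 1 ^ (k - l) * ((k.choose l : ℕ) : Matrix (Fin n) (Fin n) F) =
        (k.choose l : F) • N ^ l := fun l => by
      rw [one_pow, mul_one, ← nsmul_eq_mul', Nat.cast_smul_eq_nsmul]
    simp only [e]
    rw [Finset.sum_subset (Finset.range_mono (by lia : k + 1 ≤ r + k + 1)) fun l _ hl => ?_,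
      Finset.sum_subset (Finset.range_mono (by lia : r ≤ r + k + 1)) fun l _ hl => ?_]
    · rw [pow_eq_zero_of_le (by simpa using hl) hr, smul_zero]
    · rw [Nat.choose_eq_zero_of_lt (by simpa using hl), Nat.cast_zero, zero_smul]
  rw [h1, eval_finsetSum, Matrix.sum_apply]
  refine Finset.sum_congr rfl fun l _ => ?_
  rw [eval_mul, eval_C, descPochhammer_eval_eq_descFactorial,
    Nat.descFactorial_eq_factorial_mul_choose, Matrix.smul_apply, smul_eq_mul]
  push_cast
  field_simp [(by exact_mod_cast l.factorial_ne_zero : (l.factorial : F) ≠ 0)]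

open Polynomial in
/-- In characteristic zero, unipotent groups are connected. -/
theorem IsUnipotentSubgroup.isZariskiConnected {F : Type u} [Field F] [CharZero F] {n : ℕ}
    {U : Subgroup (GL (Fin n) F)} (hU : IsUnipotentSubgroup U) : IsZariskiConnected U := by
  rintro V hVU ⟨S, hS⟩ hidx
  refine le_antisymm hVU fun u hu => (hS u).mpr fun p hp => ?_
  obtain ⟨m, hm0, hm⟩ : ∃ m : ℕ, 0 < m ∧ u ^ m ∈ V := by
    obtain ⟨m, hm0, -, hm⟩ := Subgroup.exists_pow_mem_of_index_ne_zero hidx ⟨u, hu⟩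
    exact ⟨m, hm0, hm⟩
  obtain ⟨E, hE⟩ := Matrix.exists_powPoly (hU u hu)
  have hev : ∀ k : ℕ, (MvPolynomial.aeval (fun ij : Fin n × Fin n => E ij.1 ij.2) p).eval (k : F) =
      MvPolynomial.aeval (fun ij => (u ^ k : GL (Fin n) F) ij.1 ij.2) p := fun k => by
    have h := LinAlgGroup.aeval_map (aeval (k : F)) (Matrix.of E) p
    simp only [Matrix.of_apply, coe_aeval_eq_eval, hE] at h
    rw [← h, Units.val_pow_eq_pow_val]
  -- As a function of the exponent `k`, the value of `p` at `u ^ k` is a polynomial vanishing at all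
  -- multiples of `m`, hence also at `k = 1`.
  have hP : MvPolynomial.aeval (fun ij : Fin n × Fin n => E ij.1 ij.2) p = 0 := by
    refine eq_zero_of_infinite_isRoot _ (Set.Infinite.mono ?_
      (Set.infinite_range_of_injective (f := fun t : ℕ => ((m * t : ℕ) : F)) fun a b hab => ?_))
    · rintro _ ⟨t, rfl⟩
      change eval _ _ = 0
      rw [hev, pow_mul]
      exact (hS _).mp (pow_mem hm t) p hp
    · have : m * a = m * b := Nat.cast_injective hab
      exact Nat.eq_of_mul_eq_mul_left hm0 this
  have := hev 1
  rw [hP, eval_zero, pow_one] at this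
  exact this.symm

/-! ### Nilpotency from the theorems of Lie and Engel. -/

theorem LinearMap.eq_zero_of_trace_eq_zero {F W : Type*} [Field F] [CharZero F] [AddCommGroup W]
    [Module F W] [FiniteDimensional F W] [Nontrivial W] {f : Module.End F W} {c : F}
    (hf : ∀ w, f w = c • w) (h : LinearMap.trace F W f = 0) : c = 0 := by
  have hsc : f = c • (1 : Module.End F W) := LinearMap.ext hf
  rw [hsc, map_smul, LinearMap.trace_one, smul_eq_mul] at h
  exact (mul_eq_zero.mp h).resolve_right (by exact_mod_cast Module.finrank_pos.ne')

namespace LieModule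

open LieAlgebra

/-- If `I` is a solvable ideal of `L`, then `⁅L, I⁆` acts by nilpotent endomorphisms on every
finite-dimensional module. -/
theorem isNilpotent_toEnd_of_mem_lie_of_isSolvable {F L : Type*} {V : Type u} [Field F]
    [IsAlgClosed F] [CharZero F] [LieRing L] [LieAlgebra F L] [FiniteDimensional F L]
    [AddCommGroup V] [Module F V] [LieRingModule L V] [LieModule F L V] [FiniteDimensional F V]
    (I : LieIdeal F L) [IsSolvable I] {x : L} (hx : x ∈ ⁅(⊤ : LieIdeal F L), I⁆) :
    _root_.IsNilpotent (toEnd F L V x) := by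
  induction h : Module.finrank F V using Nat.strong_induction_on generalizing V with
  | _ d ih =>
    rcases subsingleton_or_nontrivial V with hV | hV
    · exact ⟨1, by ext v; exact Subsingleton.elim _ _⟩
    obtain ⟨χ, hχ⟩ := exists_nontrivial_weightSpace_of_isSolvable F I V
    -- The weight space of the ideal `I` is stable under all of `L`. There `x` acts by the scalar `χ
    -- x`, but has trace zero as an element of `⁅L, L⁆`; so `χ x = 0`, and induction applies to the
    -- quotient.
    obtain ⟨W, hW⟩ : ∃ W : LieSubmodule F L V, ∀ w, w ∈ W ↔ ∀ a : I, ⁅a, w⁆ = χ a • w :=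
      ⟨weightSpaceOfIsLieTower F V χ, fun w => mem_weightSpace χ w⟩
    have hWnt : Nontrivial W := by
      obtain ⟨⟨w, hw⟩, hw0⟩ := exists_ne (0 : weightSpace V χ)
      exact nontrivial_of_ne ⟨w, (hW w).mpr ((mem_weightSpace χ w).mp hw)⟩ 0
        fun h => hw0 (Subtype.ext (by simpa using h))
    have hxI : x ∈ I := LieSubmodule.lie_le_right I ⊤ hx
    have hact : ∀ w ∈ W, ⁅x, w⁆ = χ ⟨x, hxI⟩ • w := fun w hw =>
      (hW w).mp hw ⟨x, hxI⟩
    have htr : LinearMap.trace F W (toEnd F L W x) = 0 := by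
      refine trace_toEnd_eq_zero_of_mem_lcs F L W (k := 1) le_rfl ?_
      rw [lowerCentralSeries_succ, lowerCentralSeries_zero]
      have hle : ⁅(⊤ : LieIdeal F L), I⁆ ≤ ⁅(⊤ : LieIdeal F L), (⊤ : LieIdeal F L)⁆ :=
        LieSubmodule.mono_lie le_rfl le_top
      exact hle hx
    have hχ0 : χ ⟨x, hxI⟩ = 0 :=
      LinearMap.eq_zero_of_trace_eq_zero (fun w => Subtype.ext (hact w w.2)) htr
    have hlt : Module.finrank F (V ⧸ W) < d := by
      have h1 := W.toSubmodule.finrank_quotient_add_finrank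
      have h2 : 0 < Module.finrank F W := Module.finrank_pos
      have h3 : Module.finrank F (V ⧸ W) = Module.finrank F (V ⧸ W.toSubmodule) := rfl
      have h4 : Module.finrank F W = Module.finrank F W.toSubmodule := rfl
      lia
    obtain ⟨k, hk⟩ := ih _ hlt (V := V ⧸ W) rfl
    refine ⟨k + 1, ?_⟩
    ext v
    have h1 : ∀ (j : ℕ) (v : V), ((toEnd F L (V ⧸ W) x) ^ j) (LieSubmodule.Quotient.mk' W v) =
        LieSubmodule.Quotient.mk' W (((toEnd F L V x) ^ j) v) := fun j => by
      induction j with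
      | zero => exact fun v => rfl
      | succ j hj =>
        intro v
        rw [pow_succ, pow_succ, Module.End.mul_apply, Module.End.mul_apply, ← hj]
        rfl
    have h2 : ((toEnd F L V x) ^ k) v ∈ W := by
      have := h1 k v
      rw [hk] at this
      exact (LieSubmodule.Quotient.mk_eq_zero').mp this.symm
    rw [pow_succ', Module.End.mul_apply, toEnd_apply_apply, hact _ h2, hχ0, zero_smul]
    rfl

end LieModule

namespace LieSubalgebra

variable {F : Type u} [Field F] {n : ℕ}

/-- The representation of a matrix Lie algebra on column vectors. -/
def toEndHom (H : LieSubalgebra F (Matrix (Fin n) (Fin n) F)) :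
    H →ₗ⁅F⁆ Module.End F (Fin n → F) :=
  (lieEquivMatrix'.symm : Matrix (Fin n) (Fin n) F ≃ₗ⁅F⁆ Module.End F (Fin n → F)).toLieHom.comp
    H.incl

theorem isNilpotent_of_mem_lie_of_isSolvable [IsAlgClosed F] [CharZero F]
    (H : LieSubalgebra F (Matrix (Fin n) (Fin n) F)) (I : LieIdeal F H)
    [LieAlgebra.IsSolvable I] {x : H} (hx : x ∈ ⁅(⊤ : LieIdeal F H), I⁆) :
    IsNilpotent (x : Matrix (Fin n) (Fin n) F) := by
  let _ := LieRingModule.compLieHom (Fin n → F) H.toEndHom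
  let _ := LieModule.compLieHom (Fin n → F) H.toEndHom
  exact (Matrix.isNilpotent_toLin'_iff _).mp
    (LieModule.isNilpotent_toEnd_of_mem_lie_of_isSolvable (V := Fin n → F) I hx)

/-- Engel's theorem: a Lie algebra of nilpotent matrices generates an associative algebra of
nilpotent matrices. -/
theorem isNilpotent_of_mem_adjoin (J : LieSubalgebra F (Matrix (Fin n) (Fin n) F))
    (hJ : ∀ x ∈ J, IsNilpotent x) {b : Matrix (Fin n) (Fin n) F}
    (hb : b ∈ NonUnitalAlgebra.adjoin F (J : Set (Matrix (Fin n) (Fin n) F))) :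
    IsNilpotent b := by
  let _ := LieRingModule.compLieHom (Fin n → F) J.toEndHom
  let _ := LieModule.compLieHom (Fin n → F) J.toEndHom
  have hnil : LieModule.IsNilpotent J (Fin n → F) :=
    (LieModule.isNilpotent_iff_forall (R := F)).mpr fun x =>
      (Matrix.isNilpotent_toLin'_iff _).mpr (hJ x x.2)
  obtain ⟨k, hk⟩ := LieModule.IsNilpotent.nilpotent F J (Fin n → F)
  -- Unlike nilpotency itself, lowering the central series by a step passes to sums and products.
  have hstep : ∀ i, ∀ v ∈ LieModule.lowerCentralSeries F J (Fin n → F) i,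
      Matrix.toLin' b v ∈ LieModule.lowerCentralSeries F J (Fin n → F) (i + 1) := by
    induction hb using NonUnitalAlgebra.adjoin_induction with
    | mem x hx =>
      intro i v hv
      rw [LieModule.lowerCentralSeries_succ]
      exact LieSubmodule.lie_mem_lie (LieSubmodule.mem_top (⟨x, hx⟩ : J)) hv
    | add x y _ _ hx hy =>
      intro i v hv
      rw [map_add]
      exact add_mem (hx i v hv) (hy i v hv)
    | zero =>
      intro i v _
      rw [map_zero]
      exact zero_mem _
    | mul x y _ _ hx hy =>
      intro i v hv
      rw [Matrix.toLin'_mul]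
      exact LieModule.antitone_lowerCentralSeries F J (Fin n → F) (Nat.le_succ _)
        (hx _ _ (hy i v hv))
    | smul r x _ hx =>
      intro i v hv
      rw [map_smul]
      exact SMulMemClass.smul_mem r (hx i v hv)
  refine (Matrix.isNilpotent_toLin'_iff _).mp ⟨k, ?_⟩
  have hpow : ∀ i v, ((Matrix.toLin' b) ^ i) v ∈
      LieModule.lowerCentralSeries F J (Fin n → F) i := fun i => by
    induction i with
    | zero => exact fun v => LieSubmodule.mem_top _
    | succ i hi =>
      intro v
      rw [pow_succ', Module.End.mul_apply]
      exact hstep i _ (hi v)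
  refine LinearMap.ext fun v => ?_
  have := hpow k v
  rw [hk] at this
  exact (LieSubmodule.mem_bot _).mp this

end LieSubalgebra

theorem NonUnitalSubalgebra.pow_succ_mem {R A : Type*} [CommRing R] [Ring A] [Algebra R A]
    (B : NonUnitalSubalgebra R A) {b : A} (hb : b ∈ B) (k : ℕ) : b ^ (k + 1) ∈ B := by
  induction k with
  | zero => simpa using hb
  | succ k ih =>
    rw [pow_succ]
    exact mul_mem ih hb

/-! ### Congruence subgroups, and the radical of the Killing form over an algebraically closed
field. -/

namespace LinAlgGroup

variable {F : Type u} [Field F] {n : ℕ} (G : LinAlgGroup F n)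

/-- The subgroup of points of `G` which are congruent to `1` modulo a nilpotent algebra. -/
def congruenceSubgroup (B : NonUnitalSubalgebra F (Matrix (Fin n) (Fin n) F))
    (hB : ∀ b ∈ B, IsNilpotent b) : Subgroup (GL (Fin n) F) where
  carrier := {g | g ∈ G.points F ∧ (g : Matrix (Fin n) (Fin n) F) - 1 ∈ B}
  one_mem' := ⟨(G.points F).one_mem, by simp⟩
  mul_mem' := fun {g h} hg hh => ⟨(G.points F).mul_mem hg.1 hh.1, by
    have : ((g * h : GL (Fin n) F) : Matrix (Fin n) (Fin n) F) - 1 =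
        (g - 1 : Matrix (Fin n) (Fin n) F) * (h - 1 : Matrix (Fin n) (Fin n) F) +
          ((g : Matrix (Fin n) (Fin n) F) - 1) + ((h : Matrix (Fin n) (Fin n) F) - 1) := by
      rw [Units.val_mul]
      noncomm_ring
    rw [this]
    exact add_mem (add_mem (MulMemClass.mul_mem hg.2 hh.2) hg.2) hh.2⟩
  inv_mem' := fun {g} hg => ⟨(G.points F).inv_mem hg.1, by
    -- The inverse of `1 - c` is a finite geometric series, all of whose terms except the first lie
    -- in `B`.
    set c : Matrix (Fin n) (Fin n) F := 1 - (g : Matrix (Fin n) (Fin n) F) with hc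
    have hcB : c ∈ B := by
      rw [hc, ← neg_sub]
      exact neg_mem hg.2
    obtain ⟨m, hm⟩ := hB c hcB
    have h1 := mul_neg_geom_sum c (m + 1)
    rw [pow_succ, hm, zero_mul, sub_zero] at h1
    have h2 : (g : Matrix (Fin n) (Fin n) F) = 1 - c := by rw [hc, sub_sub_cancel]
    rw [← h2] at h1
    have h3 : ((g⁻¹ : GL (Fin n) F) : Matrix (Fin n) (Fin n) F) =
        ∑ i ∈ Finset.range (m + 1), c ^ i := by
      rw [← mul_one ((g⁻¹ : GL (Fin n) F) : Matrix (Fin n) (Fin n) F), ← h1, ← mul_assoc,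
        ← Units.val_mul, inv_mul_cancel, Units.val_one, one_mul]
    rw [h3, Finset.sum_range_succ', pow_zero, add_sub_cancel_right]
    exact sum_mem fun i _ => B.pow_succ_mem hcB i⟩

/-- The condition `g - 1 ∈ B` is given by the linear forms vanishing on `B`; `q` writes them as
polynomials in the entries of `g`. -/
theorem isZariskiClosed_congruenceSubgroup (B : NonUnitalSubalgebra F (Matrix (Fin n) (Fin n) F))
    (hB : ∀ b ∈ B, IsNilpotent b) : IsZariskiClosed (G.congruenceSubgroup B hB) := by
  classical
  let q : Module.Dual F (Matrix (Fin n) (Fin n) F) → MvPolynomial (Fin n × Fin n) F := fun ℓ =>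
    ∑ ij : Fin n × Fin n, MvPolynomial.C (ℓ (Matrix.single ij.1 ij.2 1)) *
      (MvPolynomial.X ij - MvPolynomial.C ((1 : Matrix (Fin n) (Fin n) F) ij.1 ij.2))
  have hq : ∀ ℓ (g : GL (Fin n) F), MvPolynomial.aeval (fun ij => g ij.1 ij.2) (q ℓ) =
      ℓ ((g : Matrix (Fin n) (Fin n) F) - 1) := fun ℓ g => by
    conv_rhs => rw [Matrix.matrix_eq_sum_single ((g : Matrix (Fin n) (Fin n) F) - 1)]
    simp only [q, map_sum, map_mul, map_sub, MvPolynomial.aeval_X, MvPolynomial.aeval_C,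
      Fintype.sum_prod_type, Matrix.sub_apply, Algebra.algebraMap_self, RingHom.id_apply]
    refine Finset.sum_congr rfl fun i _ => Finset.sum_congr rfl fun j _ => ?_
    rw [← mul_one ((g : Matrix (Fin n) (Fin n) F) i j - (1 : Matrix (Fin n) (Fin n) F) i j),
      ← smul_eq_mul (_ - _) (1 : F), ← Matrix.smul_single, map_smul, smul_eq_mul, mul_comm]
    simp
  refine ⟨G.equations ∪ q '' B.toSubmodule.dualAnnihilator, fun g => ⟨fun hg p hp => ?_,
    fun h => ⟨fun p hp => h p (Or.inl hp), ?_⟩⟩⟩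
  · rcases hp with hp | ⟨ℓ, hℓ, rfl⟩
    · exact hg.1 p hp
    · rw [hq]
      exact (Submodule.mem_dualAnnihilator ℓ).mp hℓ _ hg.2
  · refine (Subspace.forall_mem_dualAnnihilator_apply_eq_zero_iff B.toSubmodule _).mp fun ℓ hℓ => ?_
    rw [← hq]
    exact h _ (Or.inr ⟨ℓ, hℓ, rfl⟩)

theorem Ad_apply_coe (g : G.points F) (X : G.lieAlg) :
    (G.Ad g X : Matrix (Fin n) (Fin n) F) = (g.1 : Matrix (Fin n) (Fin n) F) * X.1 *
      ((g.1⁻¹ : GL (Fin n) F) : Matrix (Fin n) (Fin n) F) := rfl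

/-- The adjoint action by Lie algebra automorphisms. -/
def AdEquiv (g : G.points F) : G.lieAlg ≃ₗ⁅F⁆ G.lieAlg where
  toLinearMap := G.Ad g
  map_lie' := fun {X Y} => by
    have h : ∀ A : Matrix (Fin n) (Fin n) F, ((g.1⁻¹ : GL (Fin n) F) : Matrix (Fin n) (Fin n) F) *
        ((g.1 : Matrix (Fin n) (Fin n) F) * A) = A := fun A => by
      rw [← mul_assoc, ← Units.val_mul, inv_mul_cancel, Units.val_one, one_mul]
    apply Subtype.ext
    change (g.1 : Matrix (Fin n) (Fin n) F) * (X.1 * Y.1 - Y.1 * X.1) *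
        ((g.1⁻¹ : GL (Fin n) F) : Matrix (Fin n) (Fin n) F) =
      (g.1 : Matrix (Fin n) (Fin n) F) * X.1 *
        ((g.1⁻¹ : GL (Fin n) F) : Matrix (Fin n) (Fin n) F) *
      ((g.1 : Matrix (Fin n) (Fin n) F) * Y.1 *
        ((g.1⁻¹ : GL (Fin n) F) : Matrix (Fin n) (Fin n) F)) -
      (g.1 : Matrix (Fin n) (Fin n) F) * Y.1 *
        ((g.1⁻¹ : GL (Fin n) F) : Matrix (Fin n) (Fin n) F) *
      ((g.1 : Matrix (Fin n) (Fin n) F) * X.1 *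
        ((g.1⁻¹ : GL (Fin n) F) : Matrix (Fin n) (Fin n) F))
    simp only [mul_sub, sub_mul, mul_assoc, h]
  invFun := G.Ad g⁻¹
  left_inv := fun X => by
    change (G.Ad g⁻¹ * G.Ad g) X = X
    rw [← map_mul, inv_mul_cancel, map_one]
    rfl
  right_inv := fun X => by
    change (G.Ad g * G.Ad g⁻¹) X = X
    rw [← map_mul, mul_inv_cancel, map_one]
    rfl

open LieAlgebra in
/-- If `G` has no nontrivial normal unipotent subgroup, then the radical of the Killing form
is central. -/
theorem lie_eq_zero_of_killingForm_eq_zero [IsAlgClosed F] [CharZero F]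
    (hG : ∀ U : Subgroup (GL (Fin n) F), U ≤ G.points F →
      (∀ g ∈ G.points F, ∀ u ∈ U, g * u * g⁻¹ ∈ U) →
      IsZariskiClosed U → IsZariskiConnected U → IsUnipotentSubgroup U → U = ⊥)
    {x : G.lieAlg} (hx : killingForm F G.lieAlg x = 0) (y : G.lieAlg) : ⁅y, x⁆ = 0 := by
  set r : LieIdeal F G.lieAlg := LieIdeal.killingCompl F G.lieAlg ⊤ with hr
  have hmem : ∀ z, z ∈ r ↔ killingForm F G.lieAlg z = 0 := fun z => by
    rw [← LinearMap.mem_ker, ← LieIdeal.coe_killingCompl_top]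
    rfl
  have hsolv : IsSolvable r := (LieIdeal.solvable_iff_le_radical F G.lieAlg r).mpr
    (killingCompl_top_le_radical F G.lieAlg)
  set J : LieIdeal F G.lieAlg := ⁅(⊤ : LieIdeal F G.lieAlg), r⁆ with hJ
  have hAdr : ∀ (g : G.points F), ∀ z ∈ r, G.AdEquiv g z ∈ r := fun g z hz => by
    rw [hmem] at *
    ext w
    obtain ⟨w, rfl⟩ : ∃ v, G.AdEquiv g v = w := (G.AdEquiv g).surjective w
    rw [killingForm_of_equiv_apply, hz]
    rfl
  have hAdJ : ∀ (g : G.points F), ∀ z ∈ J, G.AdEquiv g z ∈ J := fun g z hz => by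
    have hz' : z ∈ Submodule.span F {m | ∃ a ∈ (⊤ : LieIdeal F G.lieAlg), ∃ b ∈ r, ⁅a, b⁆ = m} := by
      rw [← LieSubmodule.lieIdeal_oper_eq_linear_span']
      exact hz
    refine (Submodule.span_le (p := J.toSubmodule.comap (G.AdEquiv g).toLinearMap)).mpr ?_ hz'
    rintro _ ⟨a, -, b, hb, rfl⟩
    change G.AdEquiv g ⁅a, b⁆ ∈ J
    rw [LieEquiv.map_lie]
    exact LieSubmodule.lie_mem_lie (LieSubmodule.mem_top _) (hAdr g b hb)
  let J' : LieSubalgebra F (Matrix (Fin n) (Fin n) F) :=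
    (J : LieSubalgebra F G.lieAlg).map G.lieAlg.incl
  have hJ' : ∀ z, z ∈ J' ↔ ∃ w ∈ J, (w : Matrix (Fin n) (Fin n) F) = z := fun z => by
    exact LieSubalgebra.mem_map _ _ _
  have hnil : ∀ z ∈ J', IsNilpotent z := fun z hz => by
    obtain ⟨w, hw, rfl⟩ := (hJ' z).mp hz
    exact G.lieAlg.isNilpotent_of_mem_lie_of_isSolvable r hw
  let B := NonUnitalAlgebra.adjoin F (J' : Set (Matrix (Fin n) (Fin n) F))
  have hB : ∀ b ∈ B, IsNilpotent b := fun b hb =>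
    LieSubalgebra.isNilpotent_of_mem_adjoin J' hnil hb
  have hconj : ∀ g ∈ G.points F, ∀ b ∈ B, (g : Matrix (Fin n) (Fin n) F) * b *
      ((g⁻¹ : GL (Fin n) F) : Matrix (Fin n) (Fin n) F) ∈ B := fun g hg b hb => by
    induction hb using NonUnitalAlgebra.adjoin_induction with
    | mem z hz =>
      obtain ⟨w, hw, rfl⟩ := (hJ' z).mp hz
      exact NonUnitalAlgebra.subset_adjoin F ((hJ' _).mpr ⟨_, hAdJ ⟨g, hg⟩ w hw, rfl⟩)
    | add a b _ _ ha hb =>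
      rw [mul_add, add_mul]
      exact add_mem ha hb
    | zero => simp
    | mul a b _ _ ha hb =>
      have : (g : Matrix (Fin n) (Fin n) F) * (a * b) *
          ((g⁻¹ : GL (Fin n) F) : Matrix (Fin n) (Fin n) F) =
          ((g : Matrix (Fin n) (Fin n) F) * a *
            ((g⁻¹ : GL (Fin n) F) : Matrix (Fin n) (Fin n) F)) *
          ((g : Matrix (Fin n) (Fin n) F) * b *
            ((g⁻¹ : GL (Fin n) F) : Matrix (Fin n) (Fin n) F)) := by
        have h : ((g⁻¹ : GL (Fin n) F) : Matrix (Fin n) (Fin n) F) *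
            (g : Matrix (Fin n) (Fin n) F) = 1 := by
          rw [← Units.val_mul, inv_mul_cancel, Units.val_one]
        simp only [mul_assoc]
        rw [← mul_assoc _ (g : Matrix (Fin n) (Fin n) F), h, one_mul]
      rw [this]
      exact MulMemClass.mul_mem ha hb
    | smul c a _ ha =>
      rw [mul_smul_comm, smul_mul_assoc]
      exact SMulMemClass.smul_mem c ha
  have hunip : IsUnipotentSubgroup (G.congruenceSubgroup B hB) := fun g hg => hB _ hg.2
  have hU := hG (G.congruenceSubgroup B hB) (fun g hg => hg.1)
    (fun g hg v hv => ⟨MulMemClass.mul_mem (MulMemClass.mul_mem hg hv.1) (InvMemClass.inv_mem hg), by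
      have : ((g * v * g⁻¹ : GL (Fin n) F) : Matrix (Fin n) (Fin n) F) - 1 =
          (g : Matrix (Fin n) (Fin n) F) * ((v : Matrix (Fin n) (Fin n) F) - 1) *
            ((g⁻¹ : GL (Fin n) F) : Matrix (Fin n) (Fin n) F) := by
        rw [mul_sub, sub_mul, mul_one, ← Units.val_mul, ← Units.val_mul, ← Units.val_mul,
          mul_inv_cancel, Units.val_one]
      rw [this]
      exact hconj g hg _ hv.2⟩)
    (G.isZariskiClosed_congruenceSubgroup B hB) hunip.isZariskiConnected hunip
  have hyx : ⁅y, x⁆ ∈ J := LieSubmodule.lie_mem_lie (LieSubmodule.mem_top _) ((hmem x).mpr hx)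
  set z := ⁅y, x⁆
  have hzJ : (z : Matrix (Fin n) (Fin n) F) ∈ J' := (hJ' _).mpr ⟨z, hyx, rfl⟩
  have hzn := hnil _ hzJ
  obtain ⟨g, hg, hge⟩ := G.exists_mem_points_eq_exp z.2 hzn
  -- `exp z - 1` is a polynomial in `z` without constant term, so it lies in the non-unital algebra
  -- `B`.
  have hgU : g ∈ G.congruenceSubgroup B hB := by
    refine ⟨hg, ?_⟩
    obtain ⟨m, hm⟩ := hzn
    rw [hge, IsNilpotent.exp_eq_sum (k := m + 1) (by rw [pow_succ, hm, zero_mul]),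
      Finset.sum_range_succ', pow_zero, Nat.factorial_zero, Nat.cast_one, inv_one, one_smul,
      add_sub_cancel_right]
    refine sum_mem fun i _ => ?_
    rw [← algebraMap_smul F (((i + 1).factorial : ℚ)⁻¹)]
    exact SMulMemClass.smul_mem _
      (B.pow_succ_mem (NonUnitalAlgebra.subset_adjoin F hzJ) i)
  rw [hU, Subgroup.mem_bot] at hgU
  rw [hgU, Units.val_one] at hge
  exact Subtype.ext (hzn.eq_zero_of_exp_eq_one hge.symm)

end LinAlgGroup

/-! ### Extension of the base field, and descent of the radical statement to `K`. -/

namespace LinAlgGroup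

variable {K : Type u} [Field K] {n : ℕ} (G : LinAlgGroup K n)

theorem aeval_dualNumber (X : Matrix (Fin n) (Fin n) K) (p : MvPolynomial (Fin n × Fin n) K) :
    MvPolynomial.aeval (fun ij => (onePlus (DualNumber.eps : K[ε]) DualNumber.eps_mul_eps X :
      GL (Fin n) K[ε]) ij.1 ij.2) p =
    TrivSqZeroExt.inl (MvPolynomial.eval
        (fun ij => (1 : Matrix (Fin n) (Fin n) K) ij.1 ij.2) p) +
      TrivSqZeroExt.inr (∑ ij : Fin n × Fin n, MvPolynomial.eval
        (fun ij => (1 : Matrix (Fin n) (Fin n) K) ij.1 ij.2) (MvPolynomial.pderiv ij p) *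
          X ij.1 ij.2) := by
  induction p using MvPolynomial.induction_on with
  | C a => simp [TrivSqZeroExt.algebraMap_eq_inl]
  | add p q hp hq =>
    rw [map_add, hp, hq]
    simp only [map_add, add_mul, Finset.sum_add_distrib, TrivSqZeroExt.inl_add,
      TrivSqZeroExt.inr_add]
    abel
  | mul_X p ij hp =>
    rw [map_mul, hp, MvPolynomial.aeval_X]
    have h1 : (onePlus (DualNumber.eps : K[ε]) DualNumber.eps_mul_eps X :
        GL (Fin n) K[ε]) ij.1 ij.2 =
        TrivSqZeroExt.inl ((1 : Matrix (Fin n) (Fin n) K) ij.1 ij.2) +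
          TrivSqZeroExt.inr (X ij.1 ij.2) := by
      by_cases h : ij.1 = ij.2 <;> ext <;>
        simp [onePlus, h, Matrix.one_apply, TrivSqZeroExt.algebraMap_eq_inl]
    rw [h1]
    have h2 : ∀ kl, MvPolynomial.pderiv kl (p * MvPolynomial.X ij) =
        MvPolynomial.X ij * MvPolynomial.pderiv kl p +
          p * (Pi.single ij 1 : Fin n × Fin n → MvPolynomial (Fin n × Fin n) K) kl := fun kl => by
      rw [Derivation.leibniz, MvPolynomial.pderiv_X, smul_eq_mul, smul_eq_mul, add_comm]
      congr 2
      by_cases h : ij = kl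
      · subst h; simp
      · simp [h, Ne.symm h]
    have h3 : ∀ kl, MvPolynomial.eval (fun ij => (1 : Matrix (Fin n) (Fin n) K) ij.1 ij.2)
        ((Pi.single ij 1 : Fin n × Fin n → MvPolynomial (Fin n × Fin n) K) kl) =
        if kl = ij then 1 else 0 := fun kl => by
      by_cases h : kl = ij
      · subst h; simp
      · simp [h]
    ext
    · simp
    · simp only [h2, map_add, map_mul, h3, MvPolynomial.eval_X, add_mul, Finset.sum_add_distrib,
        mul_assoc, ← Finset.mul_sum]
      simp [add_comm]
      exact mul_comm _ _

/-- The coefficient of `ε` is the differential at `1`. Linear equations with coefficients in `K` are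
the form of the Lie algebra that behaves well under field extension. -/
theorem mem_lieAlg_iff {X : Matrix (Fin n) (Fin n) K} :
    X ∈ G.lieAlg ↔ ∀ p ∈ G.equations, ∑ ij : Fin n × Fin n, MvPolynomial.eval
      (fun ij => (1 : Matrix (Fin n) (Fin n) K) ij.1 ij.2) (MvPolynomial.pderiv ij p) *
        X ij.1 ij.2 = 0 := by
  have h1 : ∀ p ∈ G.equations, MvPolynomial.eval
      (fun ij => (1 : Matrix (Fin n) (Fin n) K) ij.1 ij.2) p = 0 := fun p hp => by
    have := G.one_mem K p hp
    rwa [MvPolynomial.aeval_eq_eval] at this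
  refine ⟨fun h p hp => ?_, fun h p hp => ?_⟩
  · have h2 := h p hp
    rw [aeval_dualNumber] at h2
    simpa using congrArg TrivSqZeroExt.snd h2
  · rw [aeval_dualNumber, h1 p hp, h p hp]
    simp

section BaseChange

variable (F : Type u) [Field F] [Algebra K F]

/-- Extension of the base field. -/
def baseChange : LinAlgGroup F n where
  equations := MvPolynomial.map (algebraMap K F) '' G.equations
  one_mem := fun R _ _ => by
    let _ : Algebra K R := Algebra.compHom R (algebraMap K F)
    have : IsScalarTower K F R := IsScalarTower.of_algebraMap_eq fun _ => rfl
    rintro _ ⟨p, hp, rfl⟩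
    rw [MvPolynomial.aeval_map_algebraMap]
    exact G.one_mem R p hp
  mul_mem := fun R _ _ g h hg hh => by
    let _ : Algebra K R := Algebra.compHom R (algebraMap K F)
    have : IsScalarTower K F R := IsScalarTower.of_algebraMap_eq fun _ => rfl
    simp only [Set.forall_mem_image, MvPolynomial.aeval_map_algebraMap] at *
    exact G.mul_mem R g h hg hh
  inv_mem := fun R _ _ g hg => by
    let _ : Algebra K R := Algebra.compHom R (algebraMap K F)
    have : IsScalarTower K F R := IsScalarTower.of_algebraMap_eq fun _ => rfl
    simp only [Set.forall_mem_image, MvPolynomial.aeval_map_algebraMap] at *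
    exact G.inv_mem R g hg

theorem points_baseChange (R : Type u) [CommRing R] [Algebra K R] [Algebra F R]
    [IsScalarTower K F R] : (G.baseChange F).points R = G.points R := by
  ext g
  change (∀ p ∈ MvPolynomial.map (algebraMap K F) '' G.equations, _) ↔ ∀ p ∈ G.equations, _
  simp only [Set.forall_mem_image, MvPolynomial.aeval_map_algebraMap]

theorem mem_lieAlg_baseChange_iff {X : Matrix (Fin n) (Fin n) F} :
    X ∈ (G.baseChange F).lieAlg ↔ ∀ p ∈ G.equations, ∑ ij : Fin n × Fin n, MvPolynomial.eval
      (fun ij => (1 : Matrix (Fin n) (Fin n) K) ij.1 ij.2) (MvPolynomial.pderiv ij p) •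
        X ij.1 ij.2 = 0 := by
  have h1 : ∀ q : MvPolynomial (Fin n × Fin n) K, MvPolynomial.eval
      (fun ij => (1 : Matrix (Fin n) (Fin n) F) ij.1 ij.2) (MvPolynomial.map (algebraMap K F) q) =
      algebraMap K F (MvPolynomial.eval
        (fun ij => (1 : Matrix (Fin n) (Fin n) K) ij.1 ij.2) q) := fun q => by
    have h : (fun ij : Fin n × Fin n => (1 : Matrix (Fin n) (Fin n) F) ij.1 ij.2) =
        algebraMap K F ∘ fun ij => (1 : Matrix (Fin n) (Fin n) K) ij.1 ij.2 := by
      ext ij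
      by_cases h : ij.1 = ij.2 <;> simp [Matrix.one_apply, h]
    rw [MvPolynomial.eval_map, h]
    exact (MvPolynomial.eval₂_comp _ _ _).symm
  rw [mem_lieAlg_iff]
  change (∀ p ∈ MvPolynomial.map (algebraMap K F) '' G.equations, _) ↔ _
  simp only [Set.forall_mem_image, MvPolynomial.pderiv_map, h1, Algebra.smul_def]

/-- The inclusion of the Lie algebra of `G` into its extension of scalars. -/
def lieAlgMap : G.lieAlg →ₛₗ[algebraMap K F] (G.baseChange F).lieAlg where
  toFun X := ⟨X.1.map (algebraMap K F), by
    rw [mem_lieAlg_baseChange_iff]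
    intro p hp
    have h := congrArg (algebraMap K F) (G.mem_lieAlg_iff.mp X.2 p hp)
    rw [map_sum, map_zero] at h
    simpa [Algebra.smul_def] using h⟩
  map_add' X Y := by
    apply Subtype.ext
    exact Matrix.map_add _ (fun a b => map_add _ a b) _ _
  map_smul' c X := by
    apply Subtype.ext
    ext i j
    exact map_mul (algebraMap K F) c (X.1 i j)

theorem lieAlgMap_injective : Function.Injective (G.lieAlgMap F) := fun X Y h => by
  apply Subtype.ext
  exact Matrix.map_injective (algebraMap K F).injective (congrArg Subtype.val h)

theorem lieAlgMap_lie (X Y : G.lieAlg) :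
    G.lieAlgMap F ⁅X, Y⁆ = ⁅G.lieAlgMap F X, G.lieAlgMap F Y⁆ := by
  apply Subtype.ext
  change (X.1 * Y.1 - Y.1 * X.1).map (algebraMap K F) = X.1.map (algebraMap K F) *
    Y.1.map (algebraMap K F) - Y.1.map (algebraMap K F) * X.1.map (algebraMap K F)
  rw [Matrix.map_sub _ (fun a b => map_sub _ a b), Matrix.map_mul, Matrix.map_mul]

theorem span_range_lieAlgMap : Submodule.span F (Set.range (G.lieAlgMap F)) = ⊤ := by
  classical
  refine eq_top_iff.mpr fun X _ => ?_
  let c := Module.Basis.ofVectorSpace K F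
  -- The equations have coefficients in `K`, so they may be read off coordinate by coordinate in a
  -- `K`-basis of `F`.
  have hmem : ∀ k, X.1.map (c.coord k) ∈ G.lieAlg := fun k => by
    rw [mem_lieAlg_iff]
    intro p hp
    have h := congrArg (c.coord k) ((G.mem_lieAlg_baseChange_iff F).mp X.2 p hp)
    rw [map_sum, map_zero] at h
    simpa using h
  let s := Finset.univ.biUnion fun ij : Fin n × Fin n => (c.repr (X.1 ij.1 ij.2)).support
  have hX : X = ∑ k ∈ s, c k • G.lieAlgMap F ⟨_, hmem k⟩ := by
    apply Subtype.ext
    rw [AddSubmonoidClass.coe_finsetSum]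
    ext i j
    rw [Matrix.sum_apply]
    have h1 := c.linearCombination_repr (X.1 i j)
    rw [Finsupp.linearCombination_apply, Finsupp.sum_of_support_subset (s := s) _
      (Finset.subset_biUnion_of_mem (fun ij : Fin n × Fin n => (c.repr (X.1 ij.1 ij.2)).support)
        (Finset.mem_univ (i, j))) _ (by simp)] at h1
    refine h1.symm.trans (Finset.sum_congr rfl fun k _ => ?_)
    change _ = c k * algebraMap K F (c.repr (X.1 i j) k)
    rw [Algebra.smul_def, mul_comm]
  rw [hX]
  exact sum_mem fun k _ => Submodule.smul_mem _ _ (Submodule.subset_span ⟨_, rfl⟩)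

theorem linearIndependent_lieAlgMap {ι : Type*} [Fintype ι] (b : Module.Basis ι K G.lieAlg) :
    LinearIndependent F fun i => G.lieAlgMap F (b i) := by
  rw [Fintype.linearIndependent_iff]
  intro a ha i
  let c := Module.Basis.ofVectorSpace K F
  refine c.ext_elem fun k => ?_
  have hsum : ∑ j, c.repr (a j) k • b j = 0 := by
    apply Subtype.ext
    rw [AddSubmonoidClass.coe_finsetSum]
    ext p q
    have h := congrArg (fun Y : (G.baseChange F).lieAlg => c.repr (Y.1 p q) k) ha
    simp only [AddSubmonoidClass.coe_finsetSum, Matrix.sum_apply, map_sum,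
      Finsupp.coe_finsetSum, Finset.sum_apply] at h
    rw [Matrix.sum_apply]
    refine Eq.trans (Finset.sum_congr rfl fun j _ => ?_) (h.trans (by simp))
    change c.repr (a j) k * (b j).1 p q = c.repr (a j * algebraMap K F ((b j).1 p q)) k
    rw [mul_comm (a j), ← Algebra.smul_def, map_smul, Finsupp.smul_apply, smul_eq_mul, mul_comm]
  have h := Fintype.linearIndependent_iff.mp b.linearIndependent _ hsum i
  simpa using h

/-- A `K`-basis of the Lie algebra becomes an `F`-basis, in which `T'` has the same matrix as `T`.
-/
theorem trace_lieAlgMap (T : Module.End K G.lieAlg) (T' : Module.End F (G.baseChange F).lieAlg)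
    (h : ∀ x, T' (G.lieAlgMap F x) = G.lieAlgMap F (T x)) :
    LinearMap.trace F _ T' = algebraMap K F (LinearMap.trace K _ T) := by
  let b := Module.finBasis K G.lieAlg
  have hspan : ⊤ ≤ Submodule.span F (Set.range fun i => G.lieAlgMap F (b i)) := by
    rw [← G.span_range_lieAlgMap F, Submodule.span_le]
    rintro _ ⟨x, rfl⟩
    rw [← b.sum_repr x, map_sum]
    refine sum_mem fun i _ => ?_
    rw [LinearMap.map_smulₛₗ]
    exact Submodule.smul_mem _ _ (Submodule.subset_span ⟨i, rfl⟩)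
  let b' := Module.Basis.mk (G.linearIndependent_lieAlgMap F b) hspan
  have hb' : ∀ i, b' i = G.lieAlgMap F (b i) := fun i => Module.Basis.mk_apply _ _ i
  have hrepr : ∀ x i, b'.repr (G.lieAlgMap F x) i = algebraMap K F (b.repr x i) := fun x i => by
    conv_lhs => rw [← b.sum_repr x, map_sum]
    simp only [LinearMap.map_smulₛₗ, ← hb']
    rw [b'.repr_sum_self]
  rw [LinearMap.trace_eq_matrix_trace F b', LinearMap.trace_eq_matrix_trace K b,
    Matrix.trace, Matrix.trace, map_sum]
  refine Finset.sum_congr rfl fun i _ => ?_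
  rw [Matrix.diag_apply, Matrix.diag_apply, LinearMap.toMatrix_apply, LinearMap.toMatrix_apply,
    hb', h, hrepr]

theorem killingForm_lieAlgMap (x y : G.lieAlg) :
    killingForm F (G.baseChange F).lieAlg (G.lieAlgMap F x) (G.lieAlgMap F y) =
      algebraMap K F (killingForm K G.lieAlg x y) := by
  rw [killingForm_apply_apply, killingForm_apply_apply]
  refine G.trace_lieAlgMap F _ _ fun z => ?_
  simp [lieAlgMap_lie]

end BaseChange

/-- The radical of the Killing form of a reductive group in characteristic zero is central. -/
theorem IsReductive.ad_eq_zero_of_killingForm_eq_zero [CharZero K] {G : LinAlgGroup K n}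
    (hG : G.IsReductive) (x : G.lieAlg) (hx : killingForm K G.lieAlg x = 0) :
    LieAlgebra.ad K G.lieAlg x = 0 := by
  let F := AlgebraicClosure K
  have hF : CharZero F := charZero_of_injective_algebraMap (algebraMap K F).injective
  have hx' : killingForm F (G.baseChange F).lieAlg (G.lieAlgMap F x) = 0 := by
    ext y
    have hy : y ∈ Submodule.span F (Set.range (G.lieAlgMap F)) :=
      (G.span_range_lieAlgMap F) ▸ Submodule.mem_top
    refine (Submodule.span_le (p := LinearMap.ker (killingForm F (G.baseChange F).lieAlg
      (G.lieAlgMap F x)))).mpr ?_ hy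
    rintro _ ⟨z, rfl⟩
    change killingForm F (G.baseChange F).lieAlg (G.lieAlgMap F x) (G.lieAlgMap F z) = 0
    rw [killingForm_lieAlgMap, hx]
    simp
  ext1 y
  have h := (G.baseChange F).lie_eq_zero_of_killingForm_eq_zero
    (by rw [points_baseChange]; exact hG) hx' (G.lieAlgMap F y)
  rw [← lieAlgMap_lie] at h
  have h0 : ⁅y, x⁆ = 0 := G.lieAlgMap_injective F (h.trans (map_zero _).symm)
  rw [LieAlgebra.ad_apply, ← lie_skew, h0, neg_zero]
  rfl

end LinAlgGroup

/-! ### Rational semisimple elements: diagonalization and integral eigenvalues. -/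

namespace Module.End

variable {K : Type*} [Field K] {V : Type*} [AddCommGroup V] [Module K V]

theorem aeval_restrict_apply {T : Module.End K V} {C : Submodule K V} (hC : ∀ v ∈ C, T v ∈ C)
    (p : Polynomial K) (v : C) :
    ((Polynomial.aeval (T.restrict hC) p v : C) : V) = Polynomial.aeval T p v := by
  have hpow : ∀ (i : ℕ) (v : C), (((T.restrict hC) ^ i) v : V) = (T ^ i) v := fun i => by
    induction i with
    | zero => exact fun v => rfl
    | succ i ih =>
      intro v
      rw [pow_succ, pow_succ, Module.End.mul_apply, Module.End.mul_apply, ih]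
      rfl
  induction p using Polynomial.induction_on' with
  | add p q hp hq => simp [hp, hq]
  | monomial i a =>
    simp only [Polynomial.aeval_monomial, Module.End.mul_apply, Module.algebraMap_end_apply,
      Submodule.coe_smul, hpow]

variable [FiniteDimensional K V]

/-- A semisimple endomorphism with rational eigenvalues is diagonalizable. -/
theorem IsSemisimple.iSup_eigenspace_rat_eq_top {T : Module.End K V} (hT : T.IsSemisimple)
    (h : ∀ μ ∈ T.charpoly.aroots (AlgebraicClosure K), ∃ q : ℚ, μ = (q : AlgebraicClosure K)) :
    ⨆ q : ℚ, T.eigenspace (q : K) = ⊤ := by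
  have hinv : (⨆ q : ℚ, T.eigenspace (q : K)) ∈ T.invtSubmodule := by
    rw [Module.End.mem_invtSubmodule]
    refine iSup_le fun q v hv => Submodule.mem_iSup_of_mem q ?_
    rw [Module.End.mem_eigenspace_iff] at *
    rw [hv, map_smul, hv]
  -- On a nonzero invariant complement `C` the minimal polynomial has a root, rational by `h`; the
  -- resulting eigenvector would lie both in `C` and in the sum of the rational eigenspaces.
  obtain ⟨C, hC, hcompl⟩ := Module.End.isSemisimple_iff.mp hT _ hinv
  suffices hbot : C = ⊥ by
    have := hcompl.sup_eq_top
    rwa [hbot, sup_bot_eq] at this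
  by_contra hne
  have hCT : ∀ v ∈ C, T v ∈ C := fun v hv => (Module.End.mem_invtSubmodule T).mp hC hv
  have hnt : Nontrivial C := Submodule.nontrivial_iff_ne_bot.mpr hne
  set T' : Module.End K C := T.restrict hCT with hT'
  have hdvd : minpoly K T' ∣ T.charpoly := minpoly.dvd K T' <| by
    ext v
    rw [hT', aeval_restrict_apply hCT, LinearMap.aeval_self_charpoly]
    rfl
  have hdeg : (minpoly K T').degree ≠ 0 :=
    (minpoly.degree_pos (Algebra.IsIntegral.isIntegral T')).ne'
  obtain ⟨μ, hμ⟩ := IsAlgClosed.exists_aeval_eq_zero (AlgebraicClosure K) _ hdeg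
  obtain ⟨q, rfl⟩ := h μ (by
    rw [Polynomial.mem_aroots]
    refine ⟨T.charpoly_monic.ne_zero, ?_⟩
    obtain ⟨r, hr⟩ := hdvd
    rw [hr, map_mul, hμ, zero_mul])
  have hroot : (minpoly K T').IsRoot (q : K) := by
    refine (algebraMap K (AlgebraicClosure K)).injective ?_
    have e : (q : AlgebraicClosure K) = algebraMap K _ (q : K) := (map_ratCast _ q).symm
    rw [e, Polynomial.aeval_algebraMap_apply, Polynomial.coe_aeval_eq_eval] at hμ
    rw [hμ, map_zero]
  obtain ⟨v, hv⟩ := (Module.End.hasEigenvalue_of_isRoot hroot).exists_hasEigenvector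
  have hv1 : (v : V) ∈ ⨆ q : ℚ, T.eigenspace (q : K) := by
    refine Submodule.mem_iSup_of_mem q ?_
    rw [Module.End.mem_eigenspace_iff]
    exact congrArg Subtype.val hv.apply_eq_smul
  exact hv.2 (Subtype.ext (Submodule.disjoint_def.mp hcompl.disjoint _ hv1 v.2))

theorem exists_iSup_eigenspace_smul_eq_top [CharZero K] {T : Module.End K V}
    (h : ⨆ q : ℚ, T.eigenspace (q : K) = ⊤) :
    ∃ m : ℕ, 0 < m ∧ ⨆ j : ℤ, ((m : K) • T).eigenspace (j : K) = ⊤ := by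
  have hfin : {q : ℚ | T.HasEigenvalue (q : K)}.Finite :=
    T.finite_hasEigenvalue.preimage (Rat.cast_injective.injOn)
  -- The multiplier clears the denominators of the finitely many rational eigenvalues.
  refine ⟨∏ q ∈ hfin.toFinset, q.den, Finset.prod_pos fun q _ => q.den_pos, ?_⟩
  rw [eq_top_iff, ← h]
  refine iSup_le fun q => ?_
  by_cases hq : T.HasEigenvalue (q : K)
  · obtain ⟨c, hc⟩ := Finset.dvd_prod_of_mem (fun q : ℚ => q.den) (hfin.mem_toFinset.mpr hq)
    refine le_iSup_of_le (c * q.num) fun v hv => ?_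
    rw [Module.End.mem_eigenspace_iff] at *
    rw [hc, LinearMap.smul_apply, hv, smul_smul]
    congr 1
    have : ((q.den * q : ℚ) : K) = (q.num : ℚ) := by rw [Rat.den_mul_eq_num]
    push_cast at this ⊢
    rw [mul_right_comm, this, mul_comm]
  · have : T.eigenspace (q : K) = ⊥ := not_not.mp hq
    rw [this]
    exact bot_le

end Module.End

/-! ### Conjugation by exponentials of elements of positive degree. -/

namespace Matrix

variable {K : Type u} [Field K] [CharZero K] {n : ℕ}

/-- Left and right multiplication by `a` commute, so the exponential of their difference factors.
The bound `N ≤ M` allows the first terms of the sum to be split off. -/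
theorem exp_neg_mul_mul_exp {a : Matrix (Fin n) (Fin n) K} {N : ℕ} (ha : a ^ N = 0)
    (u : Matrix (Fin n) (Fin n) K) :
    ∃ M, N ≤ M ∧ IsNilpotent.exp (-a) * u * IsNilpotent.exp a =
      ∑ i ∈ Finset.range M, ((i.factorial : ℚ)⁻¹) •
        (((LinearMap.mulRight K a - LinearMap.mulLeft K a) ^ i) u) := by
  have ha' : (-a) ^ N = 0 := by rw [neg_pow, ha, mul_zero]
  have e : -LinearMap.mulLeft K a = LinearMap.mulLeft K (-a) := by
    ext1 v
    simp
  have hL : (-LinearMap.mulLeft K a) ^ N = 0 := by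
    rw [e, LinearMap.pow_mulLeft, ha', LinearMap.mulLeft_zero_eq_zero]
  have hR : (LinearMap.mulRight K a) ^ N = 0 := by
    rw [LinearMap.pow_mulRight, ha, LinearMap.mulRight_zero_eq_zero]
  have hcomm : Commute (LinearMap.mulRight K a) (-LinearMap.mulLeft K a) :=
    Commute.neg_right (LinearMap.commute_mulLeft_right (R := K) a a).symm
  obtain ⟨M, hM⟩ := hcomm.isNilpotent_add ⟨N, hR⟩ ⟨N, hL⟩
  have hM' : (LinearMap.mulRight K a + -LinearMap.mulLeft K a) ^ (max M N) = 0 :=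
    pow_eq_zero_of_le (le_max_left _ _) hM
  refine ⟨max M N, le_max_right _ _, ?_⟩
  have h := IsNilpotent.exp_add_of_commute hcomm ⟨N, hR⟩ ⟨N, hL⟩
  have h1 : ∀ v, IsNilpotent.exp (LinearMap.mulRight K a) v = v * IsNilpotent.exp a := fun v => by
    rw [IsNilpotent.exp_eq_sum hR, IsNilpotent.exp_eq_sum ha, Finset.mul_sum, LinearMap.sum_apply]
    refine Finset.sum_congr rfl fun i _ => ?_
    rw [LinearMap.pow_mulRight, mul_smul_comm]
    rfl
  have h2 : IsNilpotent.exp (-LinearMap.mulLeft K a) u = IsNilpotent.exp (-a) * u := by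
    rw [IsNilpotent.exp_eq_sum hL, IsNilpotent.exp_eq_sum ha', Finset.sum_mul, LinearMap.sum_apply]
    refine Finset.sum_congr rfl fun i _ => ?_
    rw [e, LinearMap.pow_mulLeft, smul_mul_assoc]
    rfl
  rw [← h2, ← h1, ← Module.End.mul_apply, ← h, IsNilpotent.exp_eq_sum hM', LinearMap.sum_apply,
    sub_eq_add_neg]
  rfl

/-- The power `w ^ i` has weight `i * k` for the commutator with `Z`, and only finitely many weights
occur. -/
theorem isNilpotent_of_mul_sub_mul_eq_smul {Z w : Matrix (Fin n) (Fin n) K} {k : ℤ} (hk : 0 < k)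
    (h : Z * w - w * Z = (k : K) • w) : IsNilpotent w := by
  set D : Module.End K (Matrix (Fin n) (Fin n) K) :=
    LinearMap.mulLeft K Z - LinearMap.mulRight K Z with hD
  have hpow : ∀ i : ℕ, w ^ i ∈ D.eigenspace (((i * k : ℤ)) : K) := fun i => by
    rw [Module.End.mem_eigenspace_iff]
    simp only [hD, LinearMap.sub_apply, LinearMap.mulLeft_apply, LinearMap.mulRight_apply]
    induction i with
    | zero => simp
    | succ i ih =>
      have e : Z * w ^ (i + 1) - w ^ (i + 1) * Z =
          (Z * w ^ i - w ^ i * Z) * w + w ^ i * (Z * w - w * Z) := by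
        rw [pow_succ]
        noncomm_ring
      rw [e, ih, h, smul_mul_assoc, mul_smul_comm, ← pow_succ, ← add_smul]
      push_cast
      ring_nf
  obtain ⟨m, hm, -⟩ := D.exists_weightGE_eq
  refine ⟨m.toNat, ?_⟩
  have hle : m ≤ m.toNat * k := by
    nlinarith [Int.self_le_toNat m, Int.natCast_nonneg m.toNat]
  have h1 := Module.End.eigenspace_le_weightGE D hle (hpow m.toNat)
  rw [hm] at h1
  exact (Submodule.mem_bot K).mp h1

end Matrix

namespace LinAlgGroup

open Module.End LieAlgebra

variable {K : Type u} [Field K] {n : ℕ} {G : LinAlgGroup K n}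

theorem coAd_killingForm (g : G.points K) (f : G.lieAlg) :
    G.coAd g (killingForm K G.lieAlg f) = killingForm K G.lieAlg (G.AdEquiv g f) := by
  ext X
  change killingForm K G.lieAlg f (G.Ad g⁻¹ X) = _
  rw [← killingForm_of_equiv_apply (G.AdEquiv g)]
  congr 1
  exact (G.AdEquiv g).right_inv X

theorem orbit_eq_of_mem {φ ψ : Module.Dual K G.lieAlg} (h : φ ∈ G.orbit ψ) :
    G.orbit φ = G.orbit ψ := by
  obtain ⟨g, rfl⟩ := h
  ext χ
  constructor
  · rintro ⟨a, rfl⟩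
    exact ⟨a * g, by simp⟩
  · rintro ⟨a, rfl⟩
    exact ⟨a * g⁻¹, by simp [← Module.End.mul_apply, ← map_mul]⟩

theorem NilpotentOrbit.exists_killingForm (O : G.NilpotentOrbit) {φ : Module.Dual K G.lieAlg}
    (hφ : φ ∈ O.1) : ∃ f, φ = killingForm K G.lieAlg f ∧ O.1 = G.orbit φ := by
  obtain ⟨ψ, ⟨f, -, rfl⟩, hO⟩ := O.2
  rw [hO] at hφ ⊢
  rw [orbit_eq_of_mem hφ]
  obtain ⟨g, rfl⟩ := hφ
  exact ⟨G.AdEquiv g f, coAd_killingForm g f, rfl⟩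

variable [CharZero K]

theorem _root_.Matrix.isSemisimple_ad {Z : Matrix (Fin n) (Fin n) K}
    (hZ : Module.End.IsSemisimple (Matrix.toLin' Z)) :
    (ad K (Matrix (Fin n) (Fin n) K) Z).IsSemisimple := by
  refine (LinearEquiv.isSemisimple_iff _ (ad K (Module.End K (Fin n → K)) (Matrix.toLin' Z))
    (Matrix.toLin' : Matrix (Fin n) (Fin n) K ≃ₗ[K] _) ?_).mpr (ad_isSemisimple_of_isSemisimple hZ)
  refine LinearMap.ext fun Y => ?_
  change Matrix.toLin' (Z * Y - Y * Z) = Matrix.toLin' Z * Matrix.toLin' Y -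
    Matrix.toLin' Y * Matrix.toLin' Z
  rw [map_sub, Matrix.toLin'_mul, Matrix.toLin'_mul]
  rfl

theorem isSemisimple_ad {Z : G.lieAlg}
    (hZ : Module.End.IsSemisimple (Matrix.toLin' (Z : Matrix (Fin n) (Fin n) K))) :
    (ad K G.lieAlg Z).IsSemisimple := by
  have hinv : G.lieAlg.toSubmodule ∈ (ad K (Matrix (Fin n) (Fin n) K) Z.1).invtSubmodule :=
    fun Y hY => G.lieAlg.lie_mem Z.2 hY
  exact Module.End.IsSemisimple.restrict hinv (Matrix.isSemisimple_ad hZ)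

/-- Take `g = exp w`: then `Ad g⁻¹` is the exponential of `-ad w`, whose terms from the second order
on raise degrees by at least `2 * k`. -/
theorem exists_exp_point {Z w : G.lieAlg} {k : ℤ} (hk : 0 < k)
    (hw : w ∈ (ad K G.lieAlg Z).eigenspace (k : K)) :
    ∃ g : G.points K, ∀ j : ℤ, ∀ u ∈ (ad K G.lieAlg Z).weightGE j,
      ∃ v ∈ (ad K G.lieAlg Z).weightGE (j + 2 * k), G.Ad g⁻¹ u = u - ⁅w, u⁆ + v := by
  have hwn : IsNilpotent (w : Matrix (Fin n) (Fin n) K) := by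
    rw [Module.End.mem_eigenspace_iff, ad_apply] at hw
    exact Matrix.isNilpotent_of_mul_sub_mul_eq_smul hk (congrArg Subtype.val hw)
  obtain ⟨g, hg, hge⟩ := G.exists_mem_points_eq_exp w.2 hwn
  have hginv : ((g⁻¹ : GL (Fin n) K) : Matrix (Fin n) (Fin n) K) =
      IsNilpotent.exp (-(w : Matrix (Fin n) (Fin n) K)) := by
    have h1 := IsNilpotent.exp_neg_mul_exp_self hwn
    rw [← hge] at h1
    exact Units.inv_eq_of_mul_eq_one_left h1
  refine ⟨⟨g, hg⟩, fun j u hu => ?_⟩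
  obtain ⟨N, hN⟩ := hwn
  obtain ⟨M, hNM, hM⟩ := Matrix.exp_neg_mul_mul_exp
    (pow_eq_zero_of_le (by lia : N ≤ N + 2) hN) (u : Matrix (Fin n) (Fin n) K)
  obtain ⟨M, rfl⟩ : ∃ M', M = M' + 2 := ⟨M - 2, by lia⟩
  let T : Module.End K G.lieAlg := -ad K G.lieAlg w
  have hT : ∀ i : ℕ, ((LinearMap.mulRight K (w : Matrix (Fin n) (Fin n) K) -
      LinearMap.mulLeft K (w : Matrix (Fin n) (Fin n) K)) ^ i) u = ((T ^ i) u : G.lieAlg) :=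
    fun i => by
      induction i with
      | zero => rfl
      | succ i ih =>
        rw [pow_succ', pow_succ', Module.End.mul_apply, Module.End.mul_apply, ih]
        exact (neg_sub ((w : Matrix (Fin n) (Fin n) K) * ((T ^ i) u : G.lieAlg))
          (((T ^ i) u : G.lieAlg) * (w : Matrix (Fin n) (Fin n) K))).symm
  have hTdeg : ∀ i : ℕ, (T ^ i) u ∈ (ad K G.lieAlg Z).weightGE (j + i * k) := fun i => by
    induction i with
    | zero => simpa using hu
    | succ i ih =>
      rw [pow_succ', Module.End.mul_apply]
      have h := lie_mem_weightGE (eigenspace_le_weightGE _ le_rfl hw) ih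
      refine neg_mem (weightGE_antitone _ ?_ h)
      push_cast
      linarith
  refine ⟨∑ i ∈ Finset.range M, (((i + 2).factorial : K)⁻¹) • (T ^ (i + 2)) u,
    sum_mem fun i _ => Submodule.smul_mem _ _ (weightGE_antitone _ ?_ (hTdeg (i + 2))), ?_⟩
  · push_cast
    nlinarith
  · apply Subtype.ext
    have hinv2 : (((⟨g, hg⟩ : G.points K)⁻¹).1)⁻¹ = g := inv_inv g
    rw [Ad_apply_coe, hinv2]
    change ((g⁻¹ : GL (Fin n) K) : Matrix (Fin n) (Fin n) K) * u.1 *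
      (g : Matrix (Fin n) (Fin n) K) = _
    rw [hginv, hge, hM, Finset.sum_range_succ', Finset.sum_range_succ']
    simp only [hT]
    have hT1 : (((T ^ (0 + 1)) u : G.lieAlg) : Matrix (Fin n) (Fin n) K) = -(⁅w, u⁆ : G.lieAlg) := by
      rw [zero_add, pow_one]
      rfl
    have hsum : ((∑ i ∈ Finset.range M, (((i + 2).factorial : K)⁻¹) • (T ^ (i + 2)) u :
        G.lieAlg) : Matrix (Fin n) (Fin n) K) = ∑ i ∈ Finset.range M,
        (((i + 1 + 1).factorial : ℚ)⁻¹) • (((T ^ (i + 1 + 1)) u : G.lieAlg) :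
          Matrix (Fin n) (Fin n) K) := by
      rw [AddSubmonoidClass.coe_finsetSum]
      refine Finset.sum_congr rfl fun i _ => ?_
      rw [← algebraMap_smul K (((i + 1 + 1).factorial : ℚ)⁻¹)]
      simp
    change _ = u.1 - (⁅w, u⁆ : G.lieAlg).1 + ((∑ i ∈ Finset.range M,
      (((i + 2).factorial : K)⁻¹) • (T ^ (i + 2)) u : G.lieAlg) : Matrix (Fin n) (Fin n) K)
    have hT0 : (((T ^ 0) u : G.lieAlg) : Matrix (Fin n) (Fin n) K) = u := rfl
    rw [hT1, hT0, hsum]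
    simp only [zero_add, Nat.factorial_zero, Nat.factorial_one, Nat.cast_one, inv_one, one_smul]
    abel

end LinAlgGroup

/-! ### Successive conjugation and the strict drop of the invariant. -/

namespace LieAlgebra

open Module.End

variable {K : Type*} [Field K] [CharZero K] {L : Type*} [LieRing L] [LieAlgebra K L]

theorem killingForm_eq_zero_of_mem_eigenspace {Z x y : L} {i j : ℤ} (h : i + j ≠ 0)
    (hx : x ∈ (ad K L Z).eigenspace (i : K)) (hy : y ∈ (ad K L Z).eigenspace (j : K)) :
    killingForm K L x y = 0 := by
  rw [Module.End.mem_eigenspace_iff, ad_apply] at hx hy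
  have h1 := LieModule.traceForm_apply_lie_apply K L L x Z y
  rw [hy, ← lie_skew, hx, map_neg, LinearMap.neg_apply, map_smul, map_smul,
    LinearMap.smul_apply, smul_eq_mul, smul_eq_mul] at h1
  have h2 : ((i + j : ℤ) : K) * killingForm K L x y = 0 := by
    push_cast
    linear_combination -h1
  exact (mul_eq_zero.mp h2).resolve_left (by exact_mod_cast h)

/-- A functional in the image of the Killing form which lives in degrees at least `k` is the
Killing form pairing with an element of degree at least `k`. -/
theorem exists_mem_weightGE_killingForm_eq {Z : L}
    (hZ : ⨆ j : ℤ, (ad K L Z).eigenspace (j : K) = ⊤) {k : ℤ} {x : L}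
    (hx : ∀ u ∈ (ad K L Z).weightGE (1 - k), killingForm K L x u = 0) :
    ∃ y ∈ (ad K L Z).weightGE k, killingForm K L y = killingForm K L x := by
  have hsup : x ∈ (ad K L Z).weightGE k ⊔ ⨆ (j : ℤ) (_ : j < k), (ad K L Z).eigenspace (j : K) := by
    refine (iSup_le fun j => ?_ : ⨆ j : ℤ, (ad K L Z).eigenspace (j : K) ≤ _)
      (hZ ▸ Submodule.mem_top : x ∈ ⨆ j : ℤ, (ad K L Z).eigenspace (j : K))
    rcases lt_or_ge j k with h | h
    · exact le_sup_of_le_right (le_iSup₂_of_le j h le_rfl)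
    · exact le_sup_of_le_left (eigenspace_le_weightGE _ h)
  obtain ⟨y, hy, z, hz, rfl⟩ := Submodule.mem_sup.mp hsup
  -- The discarded part `z`, of degrees below `k`, pairs to zero with everything: by `hx` in degrees
  -- at least `1 - k`, and below that because the degrees do not cancel.
  refine ⟨y, hy, ?_⟩
  suffices h : killingForm K L z = 0 by rw [map_add, h, add_zero]
  ext v
  refine (iSup_le fun i v hv => ?_ : ⨆ j : ℤ, (ad K L Z).eigenspace (j : K) ≤
    LinearMap.ker (killingForm K L z))
    (hZ ▸ Submodule.mem_top : v ∈ ⨆ j : ℤ, (ad K L Z).eigenspace (j : K))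
  rw [LinearMap.mem_ker]
  rcases le_or_gt (1 - k) i with h | h
  · have h1 := hx v (eigenspace_le_weightGE _ h hv)
    rwa [map_add, LinearMap.add_apply, killingForm_eq_zero_of_mem_weightGE (by lia) hy
      (eigenspace_le_weightGE _ le_rfl hv), zero_add] at h1
  · refine (iSup₂_le fun j hj w hw => ?_ :
      ⨆ (j : ℤ) (_ : j < k), (ad K L Z).eigenspace (j : K) ≤
        LinearMap.ker ((killingForm K L).flip v)) hz
    exact killingForm_eq_zero_of_mem_eigenspace (by lia) hw hv

end LieAlgebra

namespace LinAlgGroup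

open Module.End LieAlgebra

variable {K : Type u} [Field K] {n : ℕ} {G : LinAlgGroup K n}

/-- The dimension of the centralizer of `ad f` in `End 𝔤`. -/
noncomputable def centralizerDim (f : G.lieAlg) : ℕ :=
  Module.finrank K (LinearMap.ker (commEnd (ad K G.lieAlg f)))

theorem centralizerDim_AdEquiv (g : G.points K) (f : G.lieAlg) :
    centralizerDim (G.AdEquiv g f) = centralizerDim f :=
  finrank_ker_commEnd_ad_equiv _ _

variable [CharZero K]

/-- The Killing form may be degenerate, so its pairing does not determine `f`; it does determine `ad
f`, since the radical is central. -/
theorem IsReductive.centralizerDim_congr (hG : G.IsReductive) {f f' : G.lieAlg}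
    (h : killingForm K G.lieAlg f = killingForm K G.lieAlg f') :
    centralizerDim f = centralizerDim f' := by
  have h1 : ad K G.lieAlg f = ad K G.lieAlg f' := by
    have := hG.ad_eq_zero_of_killingForm_eq_zero (f - f') (by rw [map_sub, h, sub_self])
    rw [← sub_eq_zero, ← this]
    exact (map_sub (ad K G.lieAlg).toLinearMap f f').symm
  rw [centralizerDim, h1, centralizerDim]

/-- One step of the successive conjugation of `φ + φ'` into `φ`. -/
theorem IsReductive.exists_coAd_sub_vanishing (hG : G.IsReductive) {Z f x : G.lieAlg}
    (hZ : ⨆ j : ℤ, (ad K G.lieAlg Z).eigenspace (j : K) = ⊤)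
    (hf : ∀ y, killingForm K G.lieAlg f ⁅Z, y⁆ = 0) {k : ℤ} (hk : 0 < k)
    (hx : x ∈ (ad K G.lieAlg Z).weightGE k) (heq : centralizerDim (f + x) = centralizerDim f) :
    ∃ g : G.points K, ∀ u ∈ (ad K G.lieAlg Z).weightGE (-k),
      G.coAd g (killingForm K G.lieAlg (f + x)) u = killingForm K G.lieAlg f u := by
  obtain ⟨w, hw, hwu⟩ := exists_killingForm_lie_eq hG.ad_eq_zero_of_killingForm_eq_zero hZ hf hk
    hx heq
  obtain ⟨g, hg⟩ := exists_exp_point hk hw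
  refine ⟨g, fun u hu => ?_⟩
  obtain ⟨v, hv, hgu⟩ := hg _ u hu
  -- Pair `f + x` with `u - ⁅w, u⁆ + v`: by the choice of `w` the term of `f` with `⁅w, u⁆` cancels
  -- that of `x` with `u`, and the other corrections have positive total degree.
  have h1 : killingForm K G.lieAlg f v = 0 :=
    eq_zero_of_mem_weightGE_of_lie_eq_zero hf (by lia) hv
  have h2 : killingForm K G.lieAlg x v = 0 :=
    killingForm_eq_zero_of_mem_weightGE (by lia) hx hv
  have h3 : killingForm K G.lieAlg x ⁅w, u⁆ = 0 :=
    killingForm_eq_zero_of_mem_weightGE (by lia) hx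
      (lie_mem_weightGE (eigenspace_le_weightGE _ le_rfl hw) hu)
  change killingForm K G.lieAlg (f + x) (G.Ad g⁻¹ u) = _
  rw [hgu, map_add (killingForm K G.lieAlg), LinearMap.add_apply, map_add, map_add, map_sub,
    map_sub, h1, h2, h3, hwu u hu]
  ring

/-- If adding a functional of positive degree to a functional of degree zero does not change the
dimension of the centralizer, then it does not change the orbit. -/
theorem IsReductive.exists_coAd_eq (hG : G.IsReductive) {Z f f' : G.lieAlg}
    (hZ : ⨆ j : ℤ, (ad K G.lieAlg Z).eigenspace (j : K) = ⊤)
    (hf : ∀ y, killingForm K G.lieAlg f ⁅Z, y⁆ = 0)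
    (hf' : ∀ u ∈ (ad K G.lieAlg Z).weightGE 0,
      killingForm K G.lieAlg f' u = killingForm K G.lieAlg f u)
    (heq : centralizerDim f' = centralizerDim f) :
    ∃ g : G.points K, G.coAd g (killingForm K G.lieAlg f') = killingForm K G.lieAlg f := by
  have key : ∀ k : ℕ, ∃ g : G.points K, ∃ x ∈ (ad K G.lieAlg Z).weightGE (k + 1),
      G.coAd g (killingForm K G.lieAlg f') = killingForm K G.lieAlg (f + x) := fun k => by
    induction k with
    | zero =>
      obtain ⟨x, hx, hxf⟩ := exists_mem_weightGE_killingForm_eq hZ (k := 1) (x := f' - f)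
        fun u hu => by
          rw [map_sub, LinearMap.sub_apply, hf' u (by simpa using hu), sub_self]
      exact ⟨1, x, by simpa using hx, by rw [map_one, map_add, hxf, map_sub]; simp⟩
    | succ k ih =>
      obtain ⟨g, x, hx, hgx⟩ := ih
      -- The invariant is unchanged by the conjugations made so far, so the equality needed for the
      -- next one persists.
      have heq' : centralizerDim (f + x) = centralizerDim f := by
        rw [coAd_killingForm] at hgx
        rw [← hG.centralizerDim_congr hgx, centralizerDim_AdEquiv, heq]
      obtain ⟨g', hg'⟩ := hG.exists_coAd_sub_vanishing hZ hf (by lia) hx heq'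
      rw [coAd_killingForm] at hg'
      -- Agreement in degrees at least `-(k + 1) = 1 - (k + 2)` allows a correction starting in
      -- degree `k + 2`.
      obtain ⟨y, hy, hyf⟩ := exists_mem_weightGE_killingForm_eq hZ (k := (k + 1 : ℕ) + 1)
        (x := G.AdEquiv g' (f + x) - f) fun u hu => by
          rw [map_sub, LinearMap.sub_apply, hg' u (weightGE_antitone _ (by push_cast; lia) hu),
            sub_self]
      refine ⟨g' * g, y, hy, ?_⟩
      rw [map_mul, Module.End.mul_apply, hgx, coAd_killingForm, map_add (killingForm K G.lieAlg) f y,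
        hyf, map_sub, add_sub_cancel]
  obtain ⟨m, hm, -⟩ := (ad K G.lieAlg Z).exists_weightGE_eq
  obtain ⟨g, x, hx, hgx⟩ := key m.toNat
  have hx0 : x = 0 := by
    have := weightGE_antitone _ (by lia : m ≤ m.toNat + 1) hx
    rw [hm] at this
    exact (Submodule.mem_bot K).mp this
  exact ⟨g, by rw [hgx, hx0, add_zero]⟩

theorem IsReductive.centralizerDim_le (hG : G.IsReductive) {Z f f' : G.lieAlg}
    (hZ : ⨆ j : ℤ, (ad K G.lieAlg Z).eigenspace (j : K) = ⊤)
    (hf : ∀ y, killingForm K G.lieAlg f ⁅Z, y⁆ = 0)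
    (hf' : ∀ u ∈ (ad K G.lieAlg Z).weightGE 0,
      killingForm K G.lieAlg f' u = killingForm K G.lieAlg f u) :
    centralizerDim f' ≤ centralizerDim f := by
  obtain ⟨x, hx, hxf⟩ := exists_mem_weightGE_killingForm_eq hZ (k := 1) (x := f' - f)
    fun u hu => by
      rw [map_sub, LinearMap.sub_apply, hf' u (by simpa using hu), sub_self]
  have h : killingForm K G.lieAlg f' = killingForm K G.lieAlg (f + x) := by
    rw [map_add, hxf, map_sub]
    simp
  have e : ad K G.lieAlg (f + x) = ad K G.lieAlg f + ad K G.lieAlg x :=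
    map_add (ad K G.lieAlg).toLinearMap f x
  rw [hG.centralizerDim_congr h, centralizerDim, e]
  exact (finrank_ker_commEnd_add_le hZ
    (commute_ad_of_killingForm hG.ad_eq_zero_of_killingForm_eq_zero hf) (ad_mem_weightGE hx)).1

theorem IsRationalSemisimple.exists_smul {Z : G.lieAlg} (hZ : G.IsRationalSemisimple Z) :
    ∃ m : ℕ, 0 < m ∧ ⨆ j : ℤ, (ad K G.lieAlg ((m : K) • Z)).eigenspace (j : K) = ⊤ := by
  obtain ⟨m, hm, h⟩ := exists_iSup_eigenspace_smul_eq_top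
    ((isSemisimple_ad hZ.1).iSup_eigenspace_rat_eq_top hZ.2)
  refine ⟨m, hm, ?_⟩
  have e : ad K G.lieAlg ((m : K) • Z) = (m : K) • ad K G.lieAlg Z :=
    map_smul (ad K G.lieAlg).toLinearMap _ _
  rw [e]
  exact h

/-- Since `coad` is minus the transpose of `ad`, a functional of weight `q` is supported on vectors
of weight `-q`. -/
theorem apply_eq_zero_of_mem_dualPos {Z : G.lieAlg} {m : ℕ} (hm : 0 < m)
    {φ : Module.Dual K G.lieAlg} (hφ : φ ∈ G.dualPos Z) {u : G.lieAlg}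
    (hu : u ∈ (ad K G.lieAlg ((m : K) • Z)).weightGE 0) : φ u = 0 := by
  refine (weightGE_le fun j hj u hu => ?_ :
    (ad K G.lieAlg ((m : K) • Z)).weightGE 0 ≤ LinearMap.ker φ) hu
  rw [Module.End.mem_eigenspace_iff, ad_apply, smul_lie] at hu
  refine (iSup₂_le fun q hq ψ hψ => ?_ : G.dualPos Z ≤
    LinearMap.ker (Module.Dual.eval K G.lieAlg u)) hφ
  have h1 : -ψ ⁅Z, u⁆ = (q : K) * ψ u :=
    LinearMap.congr_fun (Module.End.mem_eigenspace_iff.mp hψ) u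
  have h2 := congrArg ψ hu
  rw [map_smul, map_smul, smul_eq_mul, smul_eq_mul] at h2
  have h3 : (((m : ℚ) * q + j : ℚ) : K) * ψ u = 0 := by
    push_cast
    linear_combination -(m : K) * h1 - h2
  refine (mul_eq_zero.mp h3).resolve_left ?_
  have hpos : (0 : ℚ) < (m : ℚ) * q + j := by positivity
  exact_mod_cast hpos.ne'

theorem killingForm_smul_lie_eq_zero {Z f : G.lieAlg} (m : K)
    (hf : killingForm K G.lieAlg f ∈ G.dualEigenspace Z 0) (y : G.lieAlg) :
    killingForm K G.lieAlg f ⁅m • Z, y⁆ = 0 := by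
  have h1 : -(killingForm K G.lieAlg f ⁅Z, y⁆) = ((0 : ℚ) : K) * killingForm K G.lieAlg f y :=
    LinearMap.congr_fun (Module.End.mem_eigenspace_iff.mp hf) y
  rw [Rat.cast_zero, zero_mul, neg_eq_zero] at h1
  rw [smul_lie, map_smul, h1, smul_zero]

/-- The dimension of the centralizer of a representative of a nilpotent orbit. -/
noncomputable def NilpotentOrbit.centralizerDim (O : G.NilpotentOrbit) : ℕ :=
  LinAlgGroup.centralizerDim O.2.choose_spec.1.choose

theorem IsReductive.centralizerDim_eq (hG : G.IsReductive) (O : G.NilpotentOrbit) {f : G.lieAlg}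
    (hf : killingForm K G.lieAlg f ∈ O.1) : O.centralizerDim = LinAlgGroup.centralizerDim f := by
  have h1 := O.2.choose_spec.1.choose_spec.2
  have h2 := O.2.choose_spec.2
  rw [h2, h1] at hf
  obtain ⟨g, hg⟩ := hf
  simp only [coAd_killingForm] at hg
  rw [← hG.centralizerDim_congr hg, centralizerDim_AdEquiv]
  rfl

/-- Semicontinuity gives the weak inequality; in case of equality successive conjugation would
identify the two orbits, which `R` excludes. -/
theorem IsReductive.centralizerDim_lt (hG : G.IsReductive) {O O' : G.NilpotentOrbit}
    (h : G.R O O') : O'.centralizerDim < O.centralizerDim := by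
  obtain ⟨hne, φ, hφ, Z, hZ, φ', hφ', hφ0, hsum⟩ := h
  obtain ⟨f, rfl, hO⟩ := O.exists_killingForm hφ
  obtain ⟨f', hf', hO'⟩ := O'.exists_killingForm hsum
  obtain ⟨m, hm, hgrad⟩ := hZ.exists_smul
  have hf := killingForm_smul_lie_eq_zero (m : K) hφ0
  have hvan : ∀ u ∈ (ad K G.lieAlg ((m : K) • Z)).weightGE 0,
      killingForm K G.lieAlg f' u = killingForm K G.lieAlg f u := fun u hu => by
    rw [← hf', LinearMap.add_apply, apply_eq_zero_of_mem_dualPos hm hφ' hu, add_zero]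
  rw [hG.centralizerDim_eq O hφ, hG.centralizerDim_eq O' (hf' ▸ hsum)]
  refine lt_of_le_of_ne (hG.centralizerDim_le hgrad hf hvan) fun heq => hne ?_
  obtain ⟨g, hg⟩ := hG.exists_coAd_eq hgrad hf hvan heq
  apply Subtype.ext
  rw [hO, hO', hf', ← hg]
  exact orbit_eq_of_mem ⟨g, rfl⟩

end LinAlgGroup

theorem mainTheorem9 (K : Type u) [Field K] [NumberField K] (n : ℕ) (G : LinAlgGroup K n)
    (hG : G.IsReductive) :
    (∀ O O' : G.NilpotentOrbit, G.R O O' → ¬ G.R O' O) ∧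
      IsStrictOrder G.NilpotentOrbit (Relation.TransGen G.R) ∧
      IsPartialOrder G.NilpotentOrbit (Relation.ReflTransGen G.R) := by
  have hlt : ∀ {O O' : G.NilpotentOrbit}, Relation.TransGen G.R O O' →
      O'.centralizerDim < O.centralizerDim := fun h => by
    induction h with
    | single h => exact hG.centralizerDim_lt h
    | tail _ h ih => exact (hG.centralizerDim_lt h).trans ih
  refine ⟨fun O O' h h' => (hG.centralizerDim_lt h).asymm (hG.centralizerDim_lt h'),
    { irrefl := fun O h => (hlt h).false
      trans := fun _ _ _ => Relation.TransGen.trans },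
    { refl := fun _ => Relation.ReflTransGen.refl
      trans := fun _ _ _ => Relation.ReflTransGen.trans
      antisymm := fun O O' h h' => ?_ }⟩
  rcases Relation.reflTransGen_iff_eq_or_transGen.mp h with rfl | h
  · rfl
  · rcases Relation.reflTransGen_iff_eq_or_transGen.mp h' with rfl | h'
    · rfl
    · exact ((hlt h).asymm (hlt h')).elim
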